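/- Let $p$ be a prime number and let $F$ be a field which contains a primitive $p$-th root of unity if $p$ is odd, and a primitive fourth root of unity if $p=2$. Let $$CR(F)=F(\sqrt[p^\infty]{F^\times})$$ be the compositum, inside a separable closure of $F$, of all the fields $F(\sqrt[p^m]{a},\zeta_{p^m})$ with $a\in F^\times$ and $m\ge 1$, where $\zeta_{p^m}$ denotes a primitive $p^m$-th root of unity. Suppose that $k\ge 1$ is an integer such that $\zeta_{p^k}\in F$ but $\zeta_{p^{k+1}}\notin F$. Then $CR(F)/F$ is a Galois extension, there is a set $I$ with $\#I+1=\dim_{\mathbb F_p}F^\times/(F^\times)^p$ (an equality of cardinal numbers), and for every such set $I$ there are isomorphisms of topological groups $$\mathrm{Gal}(CR(F)/F)\;\simeq\;\langle \sigma,\tau_i,\ i\in I\mid [\tau_i,\tau_j]=1\ \ \forall i,j\in I,\quad [\sigma,\tau_i]=\tau_i^{p^k}\ \ \forall i\in I\rangle\;\simeq\;\Bigl(\prod_{i\in I}\mathbb Z_p\Bigr)\rtimes\mathbb Z_p .$$ Here $[x,y]=xyx^{-1}y^{-1}$. The group in the middle is given by a pro-$p$ presentation: it is the quotient of the free pro-$p$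 group on the set $\{\sigma\}\sqcup\{\tau_i\mid i\in I\}$ (generators converging to $1$) by the closed normal subgroup generated by the stated relations. In the semidirect product, which carries the product topology, $z\in\mathbb Z_p$ acts on $\prod_{i\in I}\mathbb Z_p$ as multiplication by $(1+p^k)^z$. The second isomorphism can be chosen to send $\sigma$ to the generator $1$ of the factor $\mathbb Z_p$ and each $\tau_i$ to the $i$-th standard unit vector of $\prod_{i\in I}\mathbb Z_p$. -/

import Mathlib

universe u

namespace CyclotomicRadical

open scoped commutatorElement

/-! ### The cyclotomic radical extension -/

/-- `F(ᵖᵐ√a, ζ_{pᵐ})`: the subfield of the separable closure generated over `F` by the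
`p^m`-th roots of `a` and the `p^m`-th roots of unity. -/
noncomputable def radicalExt (F : Type*) [Field F] (p : ℕ) (a : Fˣ) (m : ℕ) :
    IntermediateField F (SeparableClosure F) :=
  IntermediateField.adjoin F
    ({x | x ^ p ^ m = algebraMap F (SeparableClosure F) (a : F)} ∪ {z | z ^ p ^ m = 1})

/-- `CR(F)`: the compositum of the fields `F(ᵖᵐ√a, ζ_{pᵐ})`, over all `a ∈ Fˣ` and `m ≥ 1`. -/
noncomputable def CR (F : Type*) [Field F] (p : ℕ) : IntermediateField F (SeparableClosure F) :=
  ⨆ (a : Fˣ) (m : ℕ) (_ : 1 ≤ m), radicalExt F p a m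

/-! ### Free pro-`p` groups and pro-`p` presentations -/

/-- The normal subgroups of `p`-power index of the free group on `X` that contain
all but finitely many of the free generators. -/
structure ProPIndex (p : ℕ) (X : Type*) where
  sub : Subgroup (FreeGroup X)
  normal : sub.Normal
  index_eq : ∃ n : ℕ, sub.index = p ^ n
  cofinite : {x : X | FreeGroup.of x ∉ sub}.Finite

instance ProPIndex.instNormal (p : ℕ) (X : Type*) (N : ProPIndex p X) : N.sub.Normal := N.normal

/-- The finite `p`-group `FreeGroup X / N`, with the discrete topology. -/
def ProPIndex.Quot {p : ℕ} {X : Type*} (N : ProPIndex p X) : Type _ := FreeGroup X ⧸ N.sub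

instance ProPIndex.instGroup {p : ℕ} {X : Type*} (N : ProPIndex p X) : Group N.Quot :=
  inferInstanceAs (Group (FreeGroup X ⧸ N.sub))

instance ProPIndex.instTopologicalSpace {p : ℕ} {X : Type*} (N : ProPIndex p X) : TopologicalSpace N.Quot := ⊥

instance ProPIndex.instDiscreteTopology {p : ℕ} {X : Type*} (N : ProPIndex p X) : DiscreteTopology N.Quot := ⟨rfl⟩

/-- The projection `FreeGroup X → FreeGroup X / N`. -/
def ProPIndex.proj {p : ℕ} {X : Type*} (N : ProPIndex p X) : FreeGroup X →* N.Quot :=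
  QuotientGroup.mk' N.sub

/-- The transition map `FreeGroup X / N → FreeGroup X / M` for `N ≤ M`. -/
def ProPIndex.map {p : ℕ} {X : Type*} (N M : ProPIndex p X) (h : N.sub ≤ M.sub) :
    N.Quot →* M.Quot :=
  QuotientGroup.map N.sub M.sub (MonoidHom.id _) h

/-- The inverse limit of the finite `p`-groups `FreeGroup X / N`, as a subgroup of their
product. -/
def freeProPSubgroup (p : ℕ) (X : Type*) : Subgroup (∀ N : ProPIndex p X, N.Quot) where
  carrier := {f | ∀ (N M : ProPIndex p X) (h : N.sub ≤ M.sub), N.map M h (f N) = f M}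
  mul_mem' := by
    intro f g hf hg N M h
    simp [hf N M h, hg N M h]
  one_mem' := by
    intro N M h
    simp
  inv_mem' := by
    intro f hf N M h
    simp [hf N M h]

/-- The free pro-`p` group on the set `X` (converging to `1`), with the inverse limit topology. -/
abbrev FreeProP (p : ℕ) (X : Type*) : Type _ := freeProPSubgroup p X

/-- The canonical map from the abstract free group on `X` to the free pro-`p` group on `X`. -/
def FreeProP.ofWord (p : ℕ) {X : Type*} : FreeGroup X →* FreeProP p X where
  toFun w := ⟨fun N => N.proj w, fun _ _ _ => rfl⟩
  map_one' := by
    ext N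
    simp
  map_mul' := by
    intro v w
    ext N
    simp

/-- The closed normal subgroup of the free pro-`p` group on `X` generated by the relators `R`. -/
def relatorSubgroup (p : ℕ) {X : Type*} (R : Set (FreeGroup X)) : Subgroup (FreeProP p X) :=
  (Subgroup.normalClosure (FreeProP.ofWord p '' R)).topologicalClosure

instance relatorSubgroup_normal (p : ℕ) {X : Type*} (R : Set (FreeGroup X)) : (relatorSubgroup p R).Normal :=
  Subgroup.is_normal_topologicalClosure _

/-- The pro-`p` group `⟨X ∣ R⟩` with generators `X` and relators `R`, with the quotient
topology. -/
abbrev ProPPresented (p : ℕ) {X : Type*} (R : Set (FreeGroup X)) : Type _ :=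
  FreeProP p X ⧸ relatorSubgroup p R

/-- The image of a generator in `⟨X ∣ R⟩`. -/
def ProPPresented.of (p : ℕ) {X : Type*} (R : Set (FreeGroup X)) (x : X) : ProPPresented p R :=
  QuotientGroup.mk (FreeProP.ofWord p (FreeGroup.of x))

/-! ### The presentation `⟨σ, τ_i ∣ [τ_i, τ_j] = 1, [σ, τ_i] = τ_i ^ (p ^ k)⟩`

Commutators are `⁅x, y⁆ = x * y * x⁻¹ * y⁻¹`. -/

/-- The free generator `σ`. -/
def sigmaWord (I : Type*) : FreeGroup (Option I) := FreeGroup.of none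

/-- The free generator `τ_i`. -/
def tauWord {I : Type*} (i : I) : FreeGroup (Option I) := FreeGroup.of (some i)

/-- The relators `[τ_i, τ_j]` and `[σ, τ_i] τ_i ^ (-p ^ k)`. -/
def crRelators (p k : ℕ) (I : Type*) : Set (FreeGroup (Option I)) :=
  {r | ∃ i j : I, r = ⁅tauWord i, tauWord j⁆} ∪
    {r | ∃ i : I, r = ⁅sigmaWord I, tauWord i⁆ * (tauWord i ^ p ^ k)⁻¹}

/-! ### The semidirect product `(∏_{i ∈ I} ℤ_p) ⋊ ℤ_p` -/

/-- `z ↦ (1 + p ^ k) ^ z` for `z ∈ ℤ_p`: the unique continuous additive character of `ℤ_p` with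
value `1 + p ^ k` at `1`. -/
noncomputable def onePlusPow (p k : ℕ) [Fact p.Prime] (hk : 1 ≤ k) : AddChar ℤ_[p] ℤ_[p] :=
  PadicInt.addChar_of_value_at_one ((p : ℤ_[p]) ^ k) <| by
    rw [tendsto_pow_atTop_nhds_zero_iff_norm_lt_one, norm_pow]
    exact pow_lt_one₀ (norm_nonneg _) (by rw [PadicInt.norm_p]; exact inv_lt_one_of_one_lt₀ (by exact_mod_cast (Fact.out : p.Prime).one_lt)) (by omega)

/-- The action of `ℤ_p` on `∏_{i ∈ I} ℤ_p` in which `z` multiplies every coordinate by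
`(1 + p ^ k) ^ z`. -/
noncomputable def crAction (p k : ℕ) [Fact p.Prime] (hk : 1 ≤ k) (I : Type*) :
    Multiplicative ℤ_[p] →* MulAut (Multiplicative (I → ℤ_[p])) where
  toFun z :=
    { toFun := fun v => Multiplicative.ofAdd (onePlusPow p k hk z.toAdd • v.toAdd)
      invFun := fun v => Multiplicative.ofAdd (onePlusPow p k hk (-z.toAdd) • v.toAdd)
      left_inv := fun v => by
        simp [smul_smul, ← AddChar.map_add_eq_mul]
      right_inv := fun v => by
        simp [smul_smul, ← AddChar.map_add_eq_mul]
      map_mul' := fun v w => by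
        simp [smul_add] }
  map_one' := by
    ext v
    simp
  map_mul' := by
    intro y z
    ext v
    simp [AddChar.map_add_eq_mul, smul_smul]

/-- The semidirect product `(∏_{i ∈ I} ℤ_p) ⋊ ℤ_p` for the action above. -/
abbrev CRSemidirect (p k : ℕ) [Fact p.Prime] (hk : 1 ≤ k) (I : Type*) : Type _ :=
  Multiplicative (I → ℤ_[p]) ⋊[crAction p k hk I] Multiplicative ℤ_[p]

/-- The product topology on a semidirect product. -/
instance semidirectTopology {N G : Type*} [Group N] [Group G] [TopologicalSpace N] [TopologicalSpace G]
    (φ : G →* MulAut N) : TopologicalSpace (N ⋊[φ] G) :=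
  TopologicalSpace.induced SemidirectProduct.equivProd inferInstance

end CyclotomicRadical

/-!
The semidirect product is a pro-`p` group topologically generated by elements `σ`, `τ_i` that
converge to `1` and satisfy the relations, and every finite `p`-group with generators satisfying
them is compatibly a quotient of it; so it has the universal property of the presented group.

For the Galois group, choose `a_none = ζ_{p^k}` and `a_i ∈ Fˣ` forming a basis of `Fˣ/(Fˣ)ᵖ`,
together with compatible systems of `p`-power roots of them and of unity. An automorphism `s` of
`CR(F)` raises the roots of unity to a power `u ∈ 1 + p ^ k ℤ_p` and multiplies the `p`-power roots
of `a_i` by roots of unity with exponent `v_i ∈ ℤ_p`. Since `z ↦ (1 + p ^ k) ^ z` maps `ℤ_p` onto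
`1 + p ^ k ℤ_p`, the pair `(v, z)` with `u = (1 + p ^ k) ^ z` defines a continuous injective
homomorphism from `Gal(CR(F)/F)` to the semidirect product. If its image were not everything, a
nonzero continuous homomorphism from the semidirect product to `𝔽_p` would vanish on it. Such a
homomorphism is a finite linear combination of coordinates modulo `p`, so the corresponding product
of `p`-th roots of basis elements would be fixed by the Galois group, and the basis elements would
be dependent modulo `p`-th powers.
-/

namespace CyclotomicRadical

open Filter Topology

open scoped commutatorElement

section Isometry

theorem surjective_of_isometry {X : Type*} [MetricSpace X] [CompactSpace X] {f : X → X}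
    (hf : Isometry f) : Function.Surjective f := by
  by_contra! hsurj
  obtain ⟨y, hy⟩ : ∃ y, y ∉ Set.range f := by simpa [Function.Surjective] using hsurj
  obtain ⟨ε, hε, hball⟩ := Metric.isOpen_iff.1
    (isCompact_range hf.continuous).isClosed.isOpen_compl y hy
  have hfar (m d : ℕ) : ε ≤ dist (f^[m + (d + 1)] y) (f^[m] y) := by
    have hm : Isometry f^[m] := by
      induction m with
      | zero => exact isometry_id
      | succ m ih => exact ih.comp hf
    rw [Function.iterate_add_apply, hm.dist_eq, Function.iterate_succ_apply']
    by_contra! hlt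
    exact hball hlt ⟨_, rfl⟩
  obtain ⟨a, -, φ, hφ, hlim⟩ := isCompact_univ.tendsto_subseq fun n => Set.mem_univ (f^[n] y)
  obtain ⟨N, hN⟩ := Metric.cauchySeq_iff.1 hlim.cauchySeq ε hε
  obtain ⟨d, hd⟩ := Nat.exists_eq_add_of_lt (hφ N.lt_succ_self)
  have := hN (N + 1) N.le_succ N le_rfl
  simp only [Function.comp_apply, hd, add_assoc] at this
  exact this.not_ge (hfar _ d)

end Isometry

section OnePlusPow

variable {p k : ℕ} [Fact p.Prime] (hk : 1 ≤ k)

theorem continuous_onePlusPow : Continuous (onePlusPow p k hk) :=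
  PadicInt.continuous_addChar_of_value_at_one _

theorem onePlusPow_one : onePlusPow p k hk 1 = 1 + (p : ℤ_[p]) ^ k :=
  PadicInt.addChar_of_value_at_one_def _

theorem onePlusPow_natCast (n : ℕ) : onePlusPow p k hk n = (1 + (p : ℤ_[p]) ^ k) ^ n := by
  rw [← onePlusPow_one hk, ← AddChar.map_nsmul_eq_pow, nsmul_one]

theorem norm_intCast_eq_of_emultiplicity_eq {a b : ℤ}
    (h : emultiplicity (p : ℤ) a = emultiplicity (p : ℤ) b) :
    ‖(a : ℤ_[p])‖ = ‖(b : ℤ_[p])‖ := by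
  have norm_le {a b : ℤ} (h : ∀ n : ℕ, (p : ℤ) ^ n ∣ a → (p : ℤ) ^ n ∣ b) :
      ‖(b : ℤ_[p])‖ ≤ ‖(a : ℤ_[p])‖ := by
    by_contra! hlt
    have hb : (b : ℤ_[p]) ≠ 0 := norm_pos_iff.1 ((norm_nonneg _).trans_lt hlt)
    set v := (b : ℤ_[p]).valuation
    have hv : ‖(b : ℤ_[p])‖ = (p : ℝ) ^ (-v : ℤ) := PadicInt.norm_eq_zpow_neg_valuation hb
    rw [hv] at hlt
    have ha : ‖(a : ℤ_[p])‖ ≤ (p : ℝ) ^ (-(v + 1 : ℕ) : ℤ) := by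
      rw [PadicInt.norm_le_pow_iff_norm_lt_pow_add_one]
      simpa using hlt
    have hb' := PadicInt.norm_int_le_pow_iff_dvd.2 (h _ (PadicInt.norm_int_le_pow_iff_dvd.1 ha))
    rw [PadicInt.norm_le_pow_iff_norm_lt_pow_add_one, hv] at hb'
    simp at hb'
  exact le_antisymm (norm_le fun n => (emultiplicity_eq_emultiplicity_iff.1 h n).2)
    (norm_le fun n => (emultiplicity_eq_emultiplicity_iff.1 h n).1)

include hk in
theorem emultiplicity_one_add_pow_pow_sub_one (h2 : p = 2 → 2 ≤ k) (n : ℕ) :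
    emultiplicity (p : ℤ) ((1 + p ^ k) ^ n - 1) = emultiplicity (p : ℤ) (p ^ k * n) := by
  have hp : p.Prime := Fact.out
  have hdvd : (p : ℤ) ∣ p ^ k := dvd_pow_self _ (by omega)
  have hndvd : ¬ (p : ℤ) ∣ 1 + p ^ k := by
    rw [dvd_add_left hdvd, Int.natCast_dvd_ofNat]
    exact hp.not_dvd_one
  rw [emultiplicity_mul (Nat.prime_iff_prime_int.1 hp)]
  rcases hp.eq_two_or_odd' with rfl | hodd
  · have h4 : (4 : ℤ) ∣ 2 ^ k := pow_dvd_pow 2 (h2 rfl)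
    simpa using Int.two_pow_sub_pow' (x := 1 + 2 ^ k) (y := 1) n (by simpa using h4) hndvd
  · simpa [Int.natCast_emultiplicity] using
      Int.emultiplicity_pow_sub_pow hp hodd (y := 1) (by simpa using hdvd) hndvd n

theorem norm_onePlusPow_sub_one (h2 : p = 2 → 2 ≤ k) (x : ℤ_[p]) :
    ‖onePlusPow p k hk x - 1‖ = ‖(p : ℤ_[p]) ^ k‖ * ‖x‖ := by
  refine PadicInt.denseRange_natCast.induction_on x ?_ fun n => ?_
  · exact isClosed_eq ((continuous_onePlusPow hk).sub continuous_const).norm (by fun_prop)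
  · rw [onePlusPow_natCast, ← norm_mul]
    exact_mod_cast norm_intCast_eq_of_emultiplicity_eq
      (emultiplicity_one_add_pow_pow_sub_one hk h2 n)

theorem norm_onePlusPow_sub_onePlusPow (h2 : p = 2 → 2 ≤ k) (x y : ℤ_[p]) :
    ‖onePlusPow p k hk x - onePlusPow p k hk y‖ = ‖(p : ℤ_[p]) ^ k‖ * ‖x - y‖ := by
  have hunit : IsUnit (onePlusPow p k hk y) := AddChar.val_isUnit _ y
  rw [← norm_onePlusPow_sub_one hk h2, ← one_mul ‖_ - 1‖, ← PadicInt.isUnit_iff.1 hunit,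
    ← norm_mul, mul_sub, mul_one, ← AddChar.map_add_eq_mul, add_sub_cancel]

theorem onePlusPow_injective (h2 : p = 2 → 2 ≤ k) : Function.Injective (onePlusPow p k hk) := by
  intro x y hxy
  have hpk : (p : ℤ_[p]) ^ k ≠ 0 := pow_ne_zero _ PadicInt.prime_p.ne_zero
  have h := norm_onePlusPow_sub_onePlusPow hk h2 x y
  rw [hxy, sub_self, norm_zero, zero_eq_mul] at h
  exact sub_eq_zero.1 (norm_eq_zero.1 (h.resolve_left (norm_ne_zero_iff.2 hpk)))

theorem pow_dvd_onePlusPow_sub_one (x : ℤ_[p]) : (p : ℤ_[p]) ^ k ∣ onePlusPow p k hk x - 1 := by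
  rw [← Ideal.mem_span_singleton, ← PadicInt.norm_le_pow_iff_mem_span_pow]
  refine PadicInt.denseRange_natCast.induction_on x ?_ fun n => ?_
  · exact isClosed_le ((continuous_onePlusPow hk).sub continuous_const).norm continuous_const
  · rw [PadicInt.norm_le_pow_iff_mem_span_pow, Ideal.mem_span_singleton, onePlusPow_natCast]
    simpa using sub_dvd_pow_sub_pow (1 + (p : ℤ_[p]) ^ k) 1 n

-- `z ↦ ((1 + p ^ k) ^ z - 1) / p ^ k` is an isometry of the compact space `ℤ_p`, hence onto.
theorem exists_onePlusPow_eq (h2 : p = 2 → 2 ≤ k) {u : ℤ_[p]} (hu : (p : ℤ_[p]) ^ k ∣ u - 1) :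
    ∃ z, onePlusPow p k hk z = u := by
  have hpk : ‖(p : ℤ_[p]) ^ k‖ ≠ 0 := norm_ne_zero_iff.2 (pow_ne_zero _ PadicInt.prime_p.ne_zero)
  choose g hg using pow_dvd_onePlusPow_sub_one (p := p) hk
  have hiso : Isometry g := Isometry.of_dist_eq fun x y => by
    rw [dist_eq_norm, dist_eq_norm]
    refine mul_left_cancel₀ hpk ?_
    rw [← norm_mul, mul_sub, ← hg, ← hg, sub_sub_sub_cancel_right,
      norm_onePlusPow_sub_onePlusPow hk h2]
  obtain ⟨c, hc⟩ := hu
  obtain ⟨z, rfl⟩ := surjective_of_isometry hiso c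
  exact ⟨z, sub_left_injective ((hg z).trans hc.symm)⟩

end OnePlusPow

section TopologicalGroup

theorem exists_continuousMonoidHom_of_isClosed {A B : Type*} [Group A] [TopologicalSpace A]
    [Group B] [TopologicalSpace B] [CompactSpace B] {Γ : Set (A × B)} (hcl : IsClosed Γ)
    (hmul : ∀ x ∈ Γ, ∀ y ∈ Γ, x * y ∈ Γ) (hex : ∀ a, ∃! b, (a, b) ∈ Γ) :
    ∃ φ : A →ₜ* B, ∀ a, (a, φ a) ∈ Γ := by
  choose g hg hg' using hex
  have hcont : Continuous g := continuous_iff_isClosed.2 fun s hs => by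
    have hpre : g ⁻¹' s = Prod.fst '' (Γ ∩ Prod.snd ⁻¹' s) := by
      ext a
      refine ⟨fun ha => ⟨(a, g a), ⟨hg a, ha⟩, rfl⟩, ?_⟩
      rintro ⟨⟨a, b⟩, ⟨hab, hb⟩, rfl⟩
      exact (hg' a b hab).symm ▸ hb
    rw [hpre]
    exact isClosedMap_fst_of_compactSpace _ (hcl.inter (hs.preimage continuous_snd))
  exact ⟨⟨MonoidHom.mk' g fun x y => (hg' _ _ (hmul _ (hg x) _ (hg y))).symm, hcont⟩, hg⟩

/-- A bijective continuous homomorphism from a compact group to a Hausdorff group, as an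
isomorphism of topological groups. -/
noncomputable def continuousMulEquivOfBijective {A B : Type*} [Group A] [TopologicalSpace A]
    [Group B] [TopologicalSpace B] [CompactSpace A] [T2Space B] (φ : A →ₜ* B)
    (hφ : Function.Bijective φ) : A ≃ₜ* B :=
  { MulEquiv.ofBijective φ hφ with
    continuous_toFun := φ.continuous_toFun
    continuous_invFun :=
      (φ.continuous_toFun.homeoOfEquivCompactToT2 (f := Equiv.ofBijective φ hφ)).symm.continuous }

end TopologicalGroup

section IsProP

theorem exists_le_ker_of_isPGroup {p : ℕ} [Fact p.Prime] {G : Type*} [Group G] [Finite G]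
    (hG : IsPGroup p G) {H : Subgroup G} (hH : H ≠ ⊤) :
    ∃ ψ : G →* Multiplicative (ZMod p), H ≤ ψ.ker ∧ ψ ≠ 1 := by
  have hp : p.Prime := Fact.out
  obtain ⟨m, hm⟩ := IsPGroup.iff_card.1 hG
  obtain ⟨r, hr⟩ := IsPGroup.iff_card.1 (hG.to_subgroup H)
  have hrm : r < m := by
    have hlt : Nat.card H < Nat.card G :=
      (Subgroup.card_le_card_group H).lt_of_ne fun h => hH (Subgroup.eq_top_of_card_eq H h)
    rwa [hr, hm, Nat.pow_lt_pow_iff_right hp.one_lt] at hlt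
  obtain ⟨m, rfl⟩ : ∃ l, m = l + 1 := ⟨m - 1, by omega⟩
  obtain ⟨M, hM, hHM⟩ := Sylow.exists_subgroup_card_pow_prime_le p
    (hm ▸ pow_dvd_pow p m.le_succ) H hr (by omega)
  have hindex : M.index = p := by
    have h := M.card_mul_index
    rw [hM, hm, pow_succ] at h
    exact Nat.eq_of_mul_eq_mul_left (pow_pos hp.pos m) h
  have hnormal : M.Normal := Subgroup.normal_of_index_eq_minFac_card <| by
    rw [hindex, hm, hp.pow_minFac m.succ_ne_zero]
  let e : G ⧸ M ≃* Multiplicative (ZMod p) := mulEquivOfPrimeCardEq (p := p) hindex (by simp)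
  have hker : (e.toMonoidHom.comp (QuotientGroup.mk' M)).ker = M := by
    ext g
    simp
  refine ⟨e.toMonoidHom.comp (QuotientGroup.mk' M), hker.symm ▸ hHM, fun h => hp.ne_one ?_⟩
  rw [← hindex, Subgroup.index_eq_one, ← hker, h, MonoidHom.ker_one]

/-- All quotients of `G` by open normal subgroups are `p`-groups. For profinite `G` this says
that `G` is a pro-`p` group. -/
def IsProP (p : ℕ) (G : Type*) [Group G] [TopologicalSpace G] : Prop :=
  ∀ (U : Subgroup G) [U.Normal], IsOpen (U : Set G) → IsPGroup p (G ⧸ U)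

variable {p : ℕ} {G : Type*} [Group G] [TopologicalSpace G]

theorem IsProP.of_tendsto (h : ∀ g : G, Tendsto (fun n : ℕ => g ^ p ^ n) atTop (𝓝 1)) :
    IsProP p G := by
  intro U _ hU x
  obtain ⟨g, rfl⟩ := QuotientGroup.mk_surjective x
  obtain ⟨n, hn⟩ := ((h g).eventually (hU.mem_nhds U.one_mem)).exists
  exact ⟨n, (QuotientGroup.eq_one_iff (g ^ p ^ n)).2 hn⟩

theorem IsProP.multiplicative {A : Type*} [AddGroup A] [TopologicalSpace A]
    (h : ∀ a : A, Tendsto (fun n : ℕ => p ^ n • a) atTop (𝓝 0)) : IsProP p (Multiplicative A) :=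
  .of_tendsto fun a => h a.toAdd

theorem IsProP.exists_pow_mem (hG : IsProP p G) {U : Subgroup G} [U.Normal]
    (hU : IsOpen (U : Set G)) (g : G) : ∃ n : ℕ, g ^ p ^ n ∈ U := by
  obtain ⟨n, hn⟩ := hG U hU g
  exact ⟨n, (QuotientGroup.eq_one_iff (g ^ p ^ n)).1 hn⟩

theorem IsProP.exists_le_ker_of_isClosed [Fact p.Prime] [IsTopologicalGroup G] [CompactSpace G]
    [TotallyDisconnectedSpace G] (hG : IsProP p G) {H : Subgroup G} (hH : IsClosed (H : Set G))
    (hne : H ≠ ⊤) : ∃ ψ : G →ₜ* Multiplicative (ZMod p), H ≤ ψ.toMonoidHom.ker ∧ ψ ≠ 1 := by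
  obtain ⟨W, hWo, hHW, hW⟩ : ∃ W : Subgroup G, IsOpen (W : Set G) ∧ H ≤ W ∧ W ≠ ⊤ := by
    by_contra! hcon
    refine hne ((ProfiniteGrp.closedSubgroup_eq_sInf_open ⟨H, hH⟩).trans ?_)
    exact sInf_eq_top.2 fun W hW => hcon W hW.1 hW.2
  obtain ⟨V, hVW⟩ := ProfiniteGrp.exist_openNormalSubgroup_sub_open_nhds_of_one hWo W.one_mem
  let π : G →* G ⧸ (V : Subgroup G) := QuotientGroup.mk' (V : Subgroup G)
  have : Finite (G ⧸ (V : Subgroup G)) := Subgroup.quotient_finite_of_isOpen _ V.isOpen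
  have hcomap : (W.map π).comap π = W := Subgroup.comap_map_eq_self <| by
    rwa [QuotientGroup.ker_mk']
  have hmap : W.map π ≠ ⊤ := fun h => hW (by rw [← hcomap, h, Subgroup.comap_top])
  obtain ⟨ψ, hψW, hψ⟩ := exists_le_ker_of_isPGroup (hG _ V.isOpen) hmap
  have : DiscreteTopology (G ⧸ (V : Subgroup G)) := QuotientGroup.discreteTopology V.isOpen
  have hcont : Continuous (ψ ∘ π) :=
    (continuous_of_discreteTopology (f := ψ)).comp QuotientGroup.continuous_mk
  refine ⟨⟨ψ.comp π, hcont⟩,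
    fun g hg => hψW (Subgroup.mem_map_of_mem π (hHW hg)), fun h => hψ ?_⟩
  ext g
  exact DFunLike.congr_fun h g

end IsProP

section SemidirectTopology

variable {N G : Type*} [Group N] [Group G] [TopologicalSpace N] [TopologicalSpace G]
  {φ : G →* MulAut N}

/-- A semidirect product is homeomorphic to the product of its factors. -/
def semidirectHomeomorph (φ : G →* MulAut N) : N ⋊[φ] G ≃ₜ N × G :=
  SemidirectProduct.equivProd.toHomeomorphOfIsInducing ⟨rfl⟩

theorem continuous_left : Continuous (SemidirectProduct.left : N ⋊[φ] G → N) :=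
  continuous_fst.comp (semidirectHomeomorph φ).continuous

theorem continuous_right : Continuous (SemidirectProduct.right : N ⋊[φ] G → G) :=
  continuous_snd.comp (semidirectHomeomorph φ).continuous

theorem continuous_semidirect_mk {X : Type*} [TopologicalSpace X] {f : X → N} {g : X → G}
    (hf : Continuous f) (hg : Continuous g) : Continuous fun x => (⟨f x, g x⟩ : N ⋊[φ] G) :=
  (semidirectHomeomorph φ).symm.continuous.comp (hf.prodMk hg)

theorem continuous_inl : Continuous (SemidirectProduct.inl : N → N ⋊[φ] G) :=
  continuous_semidirect_mk continuous_id continuous_const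

theorem continuous_inr : Continuous (SemidirectProduct.inr : G → N ⋊[φ] G) :=
  continuous_semidirect_mk continuous_const continuous_id

instance [CompactSpace N] [CompactSpace G] : CompactSpace (N ⋊[φ] G) :=
  (semidirectHomeomorph φ).symm.compactSpace

instance [T2Space N] [T2Space G] : T2Space (N ⋊[φ] G) :=
  (semidirectHomeomorph φ).symm.t2Space

instance [TotallyDisconnectedSpace N] [TotallyDisconnectedSpace G] :
    TotallyDisconnectedSpace (N ⋊[φ] G) :=
  (semidirectHomeomorph φ).symm.totallyDisconnectedSpace

theorem isTopologicalGroup_semidirect [IsTopologicalGroup N] [IsTopologicalGroup G]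
    (hφ : Continuous fun x : G × N => φ x.1 x.2) : IsTopologicalGroup (N ⋊[φ] G) where
  continuous_mul := continuous_semidirect_mk
    ((continuous_left.comp continuous_fst).mul (hφ.comp
      ((continuous_right.comp continuous_fst).prodMk (continuous_left.comp continuous_snd))))
    ((continuous_right.comp continuous_fst).mul (continuous_right.comp continuous_snd))
  continuous_inv := continuous_semidirect_mk
    (hφ.comp (continuous_right.inv.prodMk continuous_left.inv)) continuous_right.inv

theorem IsProP.semidirect {p : ℕ} (hN : IsProP p N) (hG : IsProP p G) : IsProP p (N ⋊[φ] G) := by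
  intro U _ hU
  have exists_inl (n : N) : ∃ r : ℕ, (SemidirectProduct.inl n : N ⋊[φ] G) ^ p ^ r ∈ U := by
    simpa using hN.exists_pow_mem (U := U.comap SemidirectProduct.inl)
      (hU.preimage continuous_inl) n
  have exists_inr (g : G) : ∃ r : ℕ, (SemidirectProduct.inr g : N ⋊[φ] G) ^ p ^ r ∈ U := by
    simpa using hG.exists_pow_mem (U := U.comap SemidirectProduct.inr)
      (hU.preimage continuous_inr) g
  intro x
  obtain ⟨x, rfl⟩ := QuotientGroup.mk_surjective x
  obtain ⟨r, hr⟩ := exists_inr x.right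
  have hright : (x ^ p ^ r).right = x.right ^ p ^ r := map_pow SemidirectProduct.rightHom x _
  obtain ⟨s, hs⟩ := exists_inl (x ^ p ^ r).left
  refine ⟨r + s, ?_⟩
  rw [← QuotientGroup.eq_one_iff] at hr hs
  rw [pow_add, pow_mul, ← QuotientGroup.mk_pow, ← SemidirectProduct.inl_left_mul_inr_right
    (x ^ p ^ r), hright, map_pow, QuotientGroup.mk_mul, hr, mul_one, ← QuotientGroup.mk_pow, hs]

end SemidirectTopology

section PadicInt

variable {p : ℕ} [Fact p.Prime]

theorem tendsto_prime_pow_smul (x : ℤ_[p]) :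
    Tendsto (fun n : ℕ => p ^ n • x) atTop (𝓝 0) := by
  have h : Tendsto (fun n : ℕ => (p : ℤ_[p]) ^ n) atTop (𝓝 0) := by
    rw [tendsto_pow_atTop_nhds_zero_iff_norm_lt_one]
    exact (PadicInt.norm_p (p := p)).trans_lt
      (inv_lt_one_of_one_lt₀ (mod_cast (Fact.out : p.Prime).one_lt))
  simpa using h.mul_const x

theorem toZModPow_eq_zero_iff {n : ℕ} {x : ℤ_[p]} :
    PadicInt.toZModPow n x = 0 ↔ (p : ℤ_[p]) ^ n ∣ x := by
  rw [← RingHom.mem_ker, PadicInt.ker_toZModPow, Ideal.mem_span_singleton]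

theorem toZMod_eq_zero_iff {x : ℤ_[p]} : PadicInt.toZMod x = 0 ↔ (p : ℤ_[p]) ∣ x := by
  rw [← RingHom.mem_ker, PadicInt.ker_toZMod, PadicInt.maximalIdeal_eq_span_p,
    Ideal.mem_span_singleton]

theorem continuous_toZModPow (n : ℕ) :
    Continuous (PadicInt.toZModPow n : ℤ_[p] → ZMod (p ^ n)) := by
  refine continuous_of_continuousAt_zero (PadicInt.toZModPow n : ℤ_[p] →+* ZMod (p ^ n)) ?_
  have hball : Metric.closedBall (0 : ℤ_[p]) ((p : ℝ) ^ (-n : ℤ)) ∈ 𝓝 0 :=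
    Metric.closedBall_mem_nhds _ (zpow_pos (mod_cast (Fact.out : p.Prime).pos) _)
  refine tendsto_nhds_of_eventually_eq (mem_of_superset hball fun x hx => ?_)
  rw [mem_closedBall_zero_iff, PadicInt.norm_le_pow_iff_mem_span_pow,
    Ideal.mem_span_singleton] at hx
  simpa using toZModPow_eq_zero_iff.2 hx

theorem natCast_val_toZModPow_one (x : ℤ_[p]) :
    ((PadicInt.toZModPow 1 x).val : ZMod p) = PadicInt.toZMod x := by
  have : NeZero (p ^ 1) := ⟨by simp [(Fact.out : p.Prime).ne_zero]⟩
  have h : PadicInt.toZModPow 1 (x - ((PadicInt.toZModPow 1 x).val : ℤ_[p])) = 0 := by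
    rw [map_sub, map_natCast, ZMod.natCast_zmod_val, sub_self]
  rw [toZModPow_eq_zero_iff, pow_one, ← toZMod_eq_zero_iff, map_sub, map_natCast] at h
  exact (sub_eq_zero.1 h).symm

theorem continuous_toZMod : Continuous (PadicInt.toZMod : ℤ_[p] → ZMod p) := by
  refine ((continuous_of_discreteTopology (f := fun c : ZMod (p ^ 1) => (c.val : ZMod p))).comp
    (continuous_toZModPow 1)).congr natCast_val_toZModPow_one

theorem toZMod_onePlusPow {k : ℕ} (hk : 1 ≤ k) (z : ℤ_[p]) :
    PadicInt.toZMod (onePlusPow p k hk z) = 1 := by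
  have h := toZMod_eq_zero_iff.2
    ((dvd_pow_self (p : ℤ_[p]) (by omega : k ≠ 0)).trans (pow_dvd_onePlusPow_sub_one hk z))
  rwa [map_sub, map_one, sub_eq_zero] at h

theorem padicInt_eq_top_of_one_mem {H : AddSubgroup ℤ_[p]} (hH : IsClosed (H : Set ℤ_[p]))
    (h1 : 1 ∈ H) : H = ⊤ :=
  eq_top_iff.2 fun x _ => PadicInt.denseRange_natCast.induction_on x hH fun n => by
    simpa using H.nsmul_mem h1 n

end PadicInt

section Pi

open Classical in
theorem hasSum_pi_single {ι : Type*} {M : Type*} [AddCommMonoid M] [TopologicalSpace M]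
    (v : ι → M) : HasSum (fun i => (Pi.single i (v i) : ι → M)) v := by
  refine Pi.hasSum.2 fun j => ?_
  have h := hasSum_single (f := fun i => (Pi.single i (v i) : ι → M) j) j
    fun i hi => by rw [Pi.single_eq_of_ne hi.symm]
  simpa only [Pi.single_eq_same] using h

variable {p : ℕ} [Fact p.Prime] {I : Type*}

open Classical in
theorem pi_padicInt_eq_top_of_single_mem {H : AddSubgroup (I → ℤ_[p])}
    (hH : IsClosed (H : Set (I → ℤ_[p]))) (h1 : ∀ i, Pi.single i 1 ∈ H) : H = ⊤ := by
  have hsingle (i : I) (x : ℤ_[p]) : Pi.single i x ∈ H := by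
    have htop : H.comap (AddMonoidHom.single (fun _ => ℤ_[p]) i) = ⊤ :=
      padicInt_eq_top_of_one_mem (hH.preimage (continuous_single i)) (h1 i)
    exact (AddSubgroup.eq_top_iff' _).1 htop x
  exact eq_top_iff.2 fun v _ => hH.mem_of_tendsto (hasSum_pi_single v)
    (.of_forall fun S => H.sum_mem fun i _ => hsingle i (v i))

end Pi

section CRSemidirect

variable {p k : ℕ} [Fact p.Prime] {hk : 1 ≤ k} {I : Type*}

theorem crAction_ofAdd_one (v : Multiplicative (I → ℤ_[p])) :
    crAction p k hk I (Multiplicative.ofAdd 1) v = v * v ^ p ^ k := by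
  change Multiplicative.ofAdd (onePlusPow p k hk 1 • v.toAdd) =
    Multiplicative.ofAdd (v.toAdd + p ^ k • v.toAdd)
  rw [onePlusPow_one, add_smul, one_smul, ← Nat.cast_smul_eq_nsmul ℤ_[p], Nat.cast_pow]

theorem continuous_crAction : Continuous
    fun x : Multiplicative ℤ_[p] × Multiplicative (I → ℤ_[p]) => crAction p k hk I x.1 x.2 :=
  have hsmul : Continuous fun x : Multiplicative ℤ_[p] × Multiplicative (I → ℤ_[p]) =>
      onePlusPow p k hk x.1.toAdd • x.2.toAdd :=
    ((continuous_onePlusPow hk).comp (continuous_toAdd.comp continuous_fst)).smul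
      (continuous_toAdd.comp continuous_snd)
  continuous_ofAdd.comp hsmul

instance : IsTopologicalGroup (CRSemidirect p k hk I) :=
  isTopologicalGroup_semidirect continuous_crAction

theorem isProP_crSemidirect : IsProP p (CRSemidirect p k hk I) :=
  .semidirect
    (.multiplicative fun v => tendsto_pi_nhds.2 fun i => tendsto_prime_pow_smul (v i))
    (.multiplicative tendsto_prime_pow_smul)

open Classical in
/-- The standard topological generators of `(∏_{i ∈ I} ℤ_p) ⋊ ℤ_p`: the generator `1` of the factor
`ℤ_p` is indexed by `none`, and the `i`-th unit vector by `some i`. -/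
noncomputable def crGen (p k : ℕ) [Fact p.Prime] (hk : 1 ≤ k) (I : Type*) :
    Option I → CRSemidirect p k hk I
  | none => SemidirectProduct.inr (Multiplicative.ofAdd 1)
  | some i => SemidirectProduct.inl (Multiplicative.ofAdd (Pi.single i 1))

theorem tendsto_crGen : Tendsto (crGen p k hk I) cofinite (𝓝 1) := by
  classical
  have hsingle : Tendsto (fun i : I => (Pi.single i 1 : I → ℤ_[p])) cofinite (𝓝 0) :=
    (hasSum_pi_single fun _ : I => (1 : ℤ_[p])).summable.tendsto_cofinite_zero
  have hsome : Tendsto (fun i => crGen p k hk I (some i)) cofinite (𝓝 1) :=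
    (continuous_inl.tendsto' _ _ (map_one _)).comp hsingle
  intro U hU
  refine (((hsome hU).image some).union (Set.finite_singleton none)).subset ?_
  rintro (_ | i) hi
  · exact Or.inr rfl
  · exact Or.inl ⟨i, hi, rfl⟩

theorem eq_top_of_crGen_mem {H : Subgroup (CRSemidirect p k hk I)}
    (hH : IsClosed (H : Set (CRSemidirect p k hk I))) (hgen : ∀ j, crGen p k hk I j ∈ H) :
    H = ⊤ := by
  have hl : Subgroup.toAddSubgroup' (H.comap SemidirectProduct.inl) = ⊤ :=
    pi_padicInt_eq_top_of_single_mem (hH.preimage (continuous_inl.comp continuous_ofAdd))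
      fun i => hgen (some i)
  have hr : Subgroup.toAddSubgroup' (H.comap SemidirectProduct.inr) = ⊤ :=
    padicInt_eq_top_of_one_mem (hH.preimage (continuous_inr.comp continuous_ofAdd)) (hgen none)
  refine eq_top_iff.2 fun g _ => ?_
  rw [← SemidirectProduct.inl_left_mul_inr_right g]
  exact H.mul_mem ((AddSubgroup.eq_top_iff' _).1 hl g.left.toAdd)
    ((AddSubgroup.eq_top_iff' _).1 hr g.right.toAdd)

theorem denseRange_lift_crGen : DenseRange (FreeGroup.lift (crGen p k hk I)) := by
  have h := eq_top_of_crGen_mem (H := (FreeGroup.lift (crGen p k hk I)).range.topologicalClosure)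
    (Subgroup.isClosed_topologicalClosure _)
    fun j => Subgroup.le_topologicalClosure _ ⟨FreeGroup.of j, by simp⟩
  exact fun g => (Subgroup.eq_top_iff' _).1 h g

theorem lift_crGen_crRelators {r : FreeGroup (Option I)} (hr : r ∈ crRelators p k I) :
    FreeGroup.lift (crGen p k hk I) r = 1 := by
  rcases hr with ⟨i, j, rfl⟩ | ⟨i, rfl⟩
  · rw [map_commutatorElement, commutatorElement_eq_one_iff_mul_comm]
    simp only [tauWord, FreeGroup.lift_apply_of, crGen, ← map_mul, mul_comm]
  · simp only [sigmaWord, tauWord, map_mul, map_inv, map_pow, commutatorElement_def,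
      FreeGroup.lift_apply_of, crGen]
    rw [← map_inv SemidirectProduct.inr, ← SemidirectProduct.inl_aut, crAction_ofAdd_one, map_mul,
      map_pow, mul_inv_eq_one, mul_inv_eq_iff_eq_mul, ← pow_succ, ← pow_succ']

/-- The coordinates of `(∏_{i ∈ I} ℤ_p) ⋊ ℤ_p`, indexed like the generators `crGen`. -/
def crCoord {p k : ℕ} [Fact p.Prime] {hk : 1 ≤ k} {I : Type*} :
    Option I → CRSemidirect p k hk I → ℤ_[p]
  | none, g => g.right.toAdd
  | some i, g => g.left.toAdd i

theorem continuous_crCoord (j : Option I) :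
    Continuous (crCoord j : CRSemidirect p k hk I → ℤ_[p]) := by
  cases j with
  | none => exact continuous_toAdd.comp continuous_right
  | some i => exact (continuous_apply i).comp (continuous_toAdd.comp continuous_left)

theorem crCoord_crGen_self (j : Option I) : crCoord j (crGen p k hk I j) = 1 := by
  cases j <;> simp [crCoord, crGen]

theorem crCoord_crGen_of_ne {i j : Option I} (h : i ≠ j) : crCoord i (crGen p k hk I j) = 0 := by
  cases i <;> cases j <;> simp_all [crCoord, crGen]

theorem toZMod_crCoord_mul (j : Option I) (g h : CRSemidirect p k hk I) :
    PadicInt.toZMod (crCoord j (g * h)) =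
      PadicInt.toZMod (crCoord j g) + PadicInt.toZMod (crCoord j h) := by
  cases j <;> simp [crCoord, crAction, toZMod_onePlusPow]

theorem continuousMonoidHom_ext_crGen {A : Type*} [Group A] [TopologicalSpace A] [T2Space A]
    {ψ χ : CRSemidirect p k hk I →ₜ* A} (h : ∀ j, ψ (crGen p k hk I j) = χ (crGen p k hk I j)) :
    ψ = χ := by
  have htop : ψ.toMonoidHom.eqLocus χ.toMonoidHom = ⊤ := eq_top_of_crGen_mem
    (isClosed_eq ψ.continuous_toFun χ.continuous_toFun) h
  ext g
  exact (Subgroup.eq_top_iff' _).1 htop g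

theorem exists_toAdd_eq_sum_crCoord (ψ : CRSemidirect p k hk I →ₜ* Multiplicative (ZMod p)) :
    ∃ S : Finset (Option I), ∀ g,
      (ψ g).toAdd = ∑ j ∈ S, (ψ (crGen p k hk I j)).toAdd * PadicInt.toZMod (crCoord j g) := by
  have hfin : {j | ψ (crGen p k hk I j) ≠ 1}.Finite := by
    have h := (ψ.continuous_toFun.tendsto' 1 1 (map_one ψ)).comp (tendsto_crGen (hk := hk) (I := I))
    exact h.eventually (IsOpen.mem_nhds (isOpen_discrete {1}) rfl)
  let χ : CRSemidirect p k hk I →ₜ* Multiplicative (ZMod p) :=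
    { MonoidHom.mk' (fun g => Multiplicative.ofAdd (∑ j ∈ hfin.toFinset,
        (ψ (crGen p k hk I j)).toAdd * PadicInt.toZMod (crCoord j g))) fun g h => by
          simp only [toZMod_crCoord_mul, mul_add, Finset.sum_add_distrib, ofAdd_add] with
      continuous_toFun := continuous_ofAdd.comp <| continuous_finsetSum _ fun j _ =>
        continuous_const.mul (continuous_toZMod.comp (continuous_crCoord j)) }
  suffices h : ψ = χ from ⟨hfin.toFinset, fun g => congrArg (fun θ => (θ g).toAdd) h⟩
  refine continuousMonoidHom_ext_crGen fun j => ?_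
  change (ψ (crGen p k hk I j)).toAdd = ∑ i ∈ _, _
  rw [Finset.sum_eq_single j]
  · rw [crCoord_crGen_self, map_one, mul_one]
  · intro i _ hij
    rw [crCoord_crGen_of_ne hij, map_zero, mul_zero]
  · intro hj
    have h1 : ψ (crGen p k hk I j) = 1 := by simpa using hj
    rw [h1, toAdd_one, zero_mul]

end CRSemidirect

section ProPIndex

variable {p : ℕ} [Fact p.Prime]

theorem exists_index_eq_pow_of_pow_mem {G : Type*} [Group G] {K : Subgroup G} [K.Normal]
    [K.FiniteIndex] (h : ∀ g : G, ∃ n : ℕ, g ^ p ^ n ∈ K) : ∃ n : ℕ, K.index = p ^ n := by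
  refine IsPGroup.iff_card.1 fun x => ?_
  obtain ⟨g, rfl⟩ := QuotientGroup.mk_surjective x
  exact (h g).imp fun n hn => (QuotientGroup.eq_one_iff (g ^ p ^ n)).2 hn

namespace ProPIndex

variable {X : Type*}

theorem proj_eq_one {p : ℕ} {N : ProPIndex p X} {w : FreeGroup X} : N.proj w = 1 ↔ w ∈ N.sub :=
  QuotientGroup.eq_one_iff w

theorem proj_surjective {p : ℕ} (N : ProPIndex p X) : Function.Surjective N.proj :=
  QuotientGroup.mk'_surjective N.sub

theorem exists_pow_eq_one {p : ℕ} (N : ProPIndex p X) : ∃ n : ℕ, ∀ q : N.Quot, q ^ p ^ n = 1 := by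
  obtain ⟨n, hn⟩ := N.index_eq
  exact ⟨n, fun q => hn ▸ pow_card_eq_one' (G := FreeGroup X ⧸ N.sub) (x := q)⟩

theorem exists_forall_pow_mem {p : ℕ} (N : ProPIndex p X) :
    ∃ n : ℕ, ∀ w : FreeGroup X, w ^ p ^ n ∈ N.sub := by
  obtain ⟨n, hn⟩ := N.exists_pow_eq_one
  exact ⟨n, fun w => proj_eq_one.1 ((map_pow _ _ _).trans (hn _))⟩

instance (N : ProPIndex p X) : N.sub.FiniteIndex := by
  obtain ⟨n, hn⟩ := N.index_eq
  exact ⟨hn ▸ pow_ne_zero n (Fact.out : p.Prime).ne_zero⟩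

instance (N : ProPIndex p X) : Finite N.Quot :=
  inferInstanceAs (Finite (FreeGroup X ⧸ N.sub))

/-- The intersection of two members of the index set of the free pro-`p` group. -/
def inf (N M : ProPIndex p X) : ProPIndex p X where
  sub := N.sub ⊓ M.sub
  normal := inferInstance
  index_eq := exists_index_eq_pow_of_pow_mem fun w => by
    obtain ⟨a, ha⟩ := N.exists_forall_pow_mem
    obtain ⟨b, hb⟩ := M.exists_forall_pow_mem
    refine ⟨a + b, ?_, ?_⟩
    · rw [pow_add, pow_mul]
      exact N.sub.pow_mem (ha w) _
    · rw [pow_add, pow_mul']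
      exact M.sub.pow_mem (hb w) _
  cofinite := (N.cofinite.union M.cofinite).subset fun x hx => by
    by_contra! h
    simp_all

/-- The join of a member of the index set of the free pro-`p` group with a normal subgroup. -/
def sup (N : ProPIndex p X) (K : Subgroup (FreeGroup X)) [K.Normal] : ProPIndex p X where
  sub := N.sub ⊔ K
  normal := inferInstance
  index_eq := by
    have : (N.sub ⊔ K).FiniteIndex := Subgroup.finiteIndex_of_le le_sup_left
    obtain ⟨n, hn⟩ := N.exists_forall_pow_mem
    exact exists_index_eq_pow_of_pow_mem fun w => ⟨n, Subgroup.mem_sup_left (hn w)⟩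
  cofinite := N.cofinite.subset fun _ hx h => hx (Subgroup.mem_sup_left h)

/-- The preimage of an open normal subgroup of a pro-`p` group `G` under the homomorphism
`FreeGroup X → G` given by a family converging to `1`. -/
def comap {G : Type*} [Group G] [TopologicalSpace G] [IsTopologicalGroup G] [CompactSpace G]
    (hG : IsProP p G) {f : X → G} (hf : Tendsto f Filter.cofinite (𝓝 1))
    (U : OpenNormalSubgroup G) : ProPIndex p X where
  sub := U.toSubgroup.comap (FreeGroup.lift f)
  normal := inferInstance
  index_eq := by
    have : Finite (G ⧸ U.toSubgroup) := Subgroup.quotient_finite_of_isOpen _ U.isOpen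
    have : U.toSubgroup.FiniteIndex := Subgroup.finiteIndex_of_finite_quotient
    have : (U.toSubgroup.comap (FreeGroup.lift f)).FiniteIndex :=
      ⟨(Subgroup.index_comap _ _).trans_ne
        (U.toSubgroup.subgroupOf (FreeGroup.lift f).range).index_ne_zero_of_finite⟩
    refine exists_index_eq_pow_of_pow_mem fun w => ?_
    simpa using hG.exists_pow_mem U.isOpen (FreeGroup.lift f w)
  cofinite := by
    have hU : {x | ¬ f x ∈ U.toOpenSubgroup}.Finite :=
      hf.eventually (U.isOpen.mem_nhds U.one_mem)
    simpa using hU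

instance : Nonempty (ProPIndex p X) :=
  ⟨{ sub := ⊤, normal := inferInstance, index_eq := ⟨0, by simp⟩, cofinite := by simp }⟩

theorem exists_forall_le (T : Finset (ProPIndex p X)) :
    ∃ N : ProPIndex p X, ∀ M ∈ T, N.sub ≤ M.sub := by
  classical
  induction T using Finset.induction_on with
  | empty => exact ⟨Classical.arbitrary _, by simp⟩
  | insert M T _ ih =>
    obtain ⟨N, hN⟩ := ih
    exact ⟨M.inf N, Finset.forall_mem_insert _ _ _ |>.2
      ⟨inf_le_left, fun M' hM' => inf_le_right.trans (hN M' hM')⟩⟩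

end ProPIndex

end ProPIndex

section FreeProP

namespace FreeProP

variable {p : ℕ} {X : Type*}

theorem continuous_apply (N : ProPIndex p X) : Continuous fun x : FreeProP p X => x.1 N :=
  (_root_.continuous_apply N).comp continuous_subtype_val

theorem exists_word (x : FreeProP p X) (N : ProPIndex p X) :
    ∃ w, (ofWord p w).1 N = x.1 N :=
  N.proj_surjective (x.1 N)

theorem isClosed_freeProPSubgroup :
    IsClosed (freeProPSubgroup p X : Set (∀ N : ProPIndex p X, N.Quot)) := by
  have h : (freeProPSubgroup p X : Set (∀ N : ProPIndex p X, N.Quot)) =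
      ⋂ (N : ProPIndex p X) (M : ProPIndex p X) (h : N.sub ≤ M.sub),
        {f | N.map M h (f N) = f M} := by
    ext f
    simp only [Set.mem_iInter]
    rfl
  rw [h]
  exact isClosed_iInter fun N => isClosed_iInter fun M => isClosed_iInter fun h =>
    isClosed_eq (continuous_of_discreteTopology.comp (_root_.continuous_apply N))
      (_root_.continuous_apply M)

variable [Fact p.Prime]

instance : CompactSpace (FreeProP p X) :=
  isCompact_iff_compactSpace.1 isClosed_freeProPSubgroup.isCompact

theorem exists_subset_of_mem_nhds {x : FreeProP p X} {U : Set (FreeProP p X)} (hU : U ∈ 𝓝 x) :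
    ∃ N : ProPIndex p X, ∀ y : FreeProP p X, y.1 N = x.1 N → y ∈ U := by
  rw [nhds_subtype_eq_comap, mem_comap] at hU
  obtain ⟨V, hV, hVU⟩ := hU
  rw [nhds_pi, mem_pi'] at hV
  obtain ⟨T, W, hW, hWV⟩ := hV
  obtain ⟨N, hN⟩ := ProPIndex.exists_forall_le T
  refine ⟨N, fun y hy => hVU (hWV fun M hM => ?_)⟩
  have hyM : y.1 M = x.1 M := by rw [← y.2 N M (hN M hM), ← x.2 N M (hN M hM), hy]
  exact hyM.symm ▸ mem_of_mem_nhds (hW M)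

theorem denseRange_ofWord : DenseRange (ofWord p (X := X)) := by
  refine fun x => mem_closure_iff_nhds.2 fun U hU => ?_
  obtain ⟨N, hN⟩ := exists_subset_of_mem_nhds hU
  obtain ⟨w, hw⟩ := exists_word x N
  exact ⟨_, hN _ hw, w, rfl⟩

variable {G : Type*} [Group G] [TopologicalSpace G] [IsTopologicalGroup G]

/-- The closure of the graph of the homomorphism `FreeGroup X → G` extending `f`. It is the graph
of the extension of `f` to the free pro-`p` group. -/
def liftGraph (p : ℕ) (f : X → G) : Subgroup (FreeProP p X × G) :=
  ((ofWord p).prod (FreeGroup.lift f)).range.topologicalClosure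

theorem isClosed_liftGraph (p : ℕ) (f : X → G) :
    IsClosed (liftGraph p f : Set (FreeProP p X × G)) :=
  Subgroup.isClosed_topologicalClosure _

theorem mk_mem_liftGraph (p : ℕ) (f : X → G) (w : FreeGroup X) :
    (ofWord p w, FreeGroup.lift f w) ∈ liftGraph p f :=
  Subgroup.le_topologicalClosure _ ⟨w, rfl⟩

variable [CompactSpace G]

theorem exists_mem_liftGraph (f : X → G) (x : FreeProP p X) : ∃ g, (x, g) ∈ liftGraph p f := by
  suffices hx : x ∈ Prod.fst '' (liftGraph p f : Set (FreeProP p X × G)) by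
    obtain ⟨⟨_, g⟩, hg, rfl⟩ := hx
    exact ⟨g, hg⟩
  exact denseRange_ofWord.induction_on x
    (isClosedMap_fst_of_compactSpace _ (isClosed_liftGraph p f))
    fun w => ⟨_, mk_mem_liftGraph p f w, rfl⟩

variable [TotallyDisconnectedSpace G]

theorem eq_one_of_mem_liftGraph (hG : IsProP p G) {f : X → G} (hf : Tendsto f cofinite (𝓝 1))
    {g : G} (hg : (1, g) ∈ liftGraph p f) : g = 1 := by
  by_contra hne
  obtain ⟨U, hU⟩ := ProfiniteGrp.exist_openNormalSubgroup_sub_open_nhds_of_one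
    (isOpen_compl_singleton (x := g)) (Ne.symm hne)
  let N := ProPIndex.comap hG hf U
  have hsub : (liftGraph p f : Set (FreeProP p X × G)) ⊆ {y | y.1.1 N = 1}ᶜ ∪ {y | y.2 ∈ U} := by
    refine closure_minimal ?_ (IsClosed.union ?_ ?_)
    · rintro _ ⟨w, rfl⟩
      exact or_iff_not_imp_left.2 fun h => ProPIndex.proj_eq_one.1 (not_not.1 h)
    · exact ((isOpen_discrete {1}).preimage
        ((continuous_apply N).comp continuous_fst)).isClosed_compl
    · exact ((U : Subgroup G).isClosed_of_isOpen U.isOpen).preimage continuous_snd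
  exact (hsub hg).elim (fun h => h rfl) fun h => hU h rfl

theorem exists_lift (hG : IsProP p G) {f : X → G} (hf : Tendsto f cofinite (𝓝 1)) :
    ∃ Φ : FreeProP p X →ₜ* G, ∀ w, Φ (ofWord p w) = FreeGroup.lift f w := by
  have unique {x : FreeProP p X} {g h : G} (hg : (x, g) ∈ liftGraph p f)
      (hh : (x, h) ∈ liftGraph p f) : g = h := by
    have hgh := mul_mem (inv_mem hg) hh
    rw [Prod.inv_mk, Prod.mk_mul_mk, inv_mul_cancel] at hgh
    exact inv_mul_eq_one.1 (eq_one_of_mem_liftGraph hG hf hgh)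
  obtain ⟨Φ, hΦ⟩ := exists_continuousMonoidHom_of_isClosed (isClosed_liftGraph p f)
    (fun _ hx _ hy => mul_mem hx hy) fun x =>
      (exists_mem_liftGraph f x).imp fun g hg => ⟨hg, fun h hh => unique hh hg⟩
  exact ⟨Φ, fun w => unique (hΦ _) (mk_mem_liftGraph p f w)⟩

end FreeProP

end FreeProP

section Presentation

variable {p : ℕ} {X : Type*} [Fact p.Prime] {R : Set (FreeGroup X)}

theorem mem_relatorSubgroup_of_forall {x : FreeProP p X}
    (hx : ∀ M : ProPIndex p X, R ⊆ M.sub → x.1 M = 1) : x ∈ relatorSubgroup p R := by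
  refine mem_closure_iff_nhds.2 fun U hU => ?_
  obtain ⟨N, hN⟩ := FreeProP.exists_subset_of_mem_nhds hU
  set M := N.sup (Subgroup.normalClosure R)
  obtain ⟨w, hw⟩ := FreeProP.exists_word x N
  have hwM : w ∈ N.sub ⊔ Subgroup.normalClosure R := by
    have hR : R ⊆ M.sub :=
      Subgroup.subset_normalClosure.trans (SetLike.coe_subset_coe.2 le_sup_right)
    have hxM : M.proj w = x.1 M := by
      rw [← x.2 N M le_sup_left, ← hw]
      rfl
    exact ProPIndex.proj_eq_one.1 (hxM.trans (hx M hR))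
  obtain ⟨n, hn, r, hr, rfl⟩ := Subgroup.mem_sup_of_normal_left.1 hwM
  refine ⟨FreeProP.ofWord p r, hN _ ?_, ?_⟩
  · rw [← hw]
    change N.proj r = N.proj (n * r)
    rw [map_mul, ProPIndex.proj_eq_one.2 hn, one_mul]
  · exact Subgroup.map_normalClosure_le R (FreeProP.ofWord p) (Subgroup.mem_map_of_mem _ hr)

variable {G : Type*} [Group G] [TopologicalSpace G] {f : X → G}

theorem relatorSubgroup_eq_ker [T1Space G] {Φ : FreeProP p X →ₜ* G}
    (hΦ : ∀ w, Φ (FreeProP.ofWord p w) = FreeGroup.lift f w)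
    (hrel : ∀ r ∈ R, FreeGroup.lift f r = 1)
    (hquot : ∀ M : ProPIndex p X, R ⊆ M.sub →
      ∃ θ : G →ₜ* M.Quot, ∀ x, θ (f x) = M.proj (FreeGroup.of x)) :
    relatorSubgroup p R = Φ.toMonoidHom.ker := by
  apply le_antisymm
  · refine Subgroup.topologicalClosure_minimal _ (Subgroup.normalClosure_le_normal ?_)
      (isClosed_singleton.preimage Φ.continuous_toFun)
    rintro _ ⟨r, hr, rfl⟩
    exact (hΦ r).trans (hrel r hr)
  · refine fun x hx => mem_relatorSubgroup_of_forall fun M hM => ?_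
    obtain ⟨θ, hθ⟩ := hquot M hM
    have hlift : θ.toMonoidHom.comp (FreeGroup.lift f) = M.proj := by
      ext y
      simpa using hθ y
    have hcomp : θ ∘ Φ = fun y => y.1 M := FreeProP.denseRange_ofWord.equalizer
      (θ.continuous_toFun.comp Φ.continuous_toFun) (FreeProP.continuous_apply M) <| funext fun w =>
        (congrArg θ (hΦ w)).trans (DFunLike.congr_fun hlift w)
    rw [← congrFun hcomp x]
    exact (congrArg θ hx).trans (map_one θ)

theorem exists_proPPresented_equiv [IsTopologicalGroup G] [CompactSpace G]
    [TotallyDisconnectedSpace G] (hG : IsProP p G) (hf : Tendsto f cofinite (𝓝 1))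
    (hdense : DenseRange (FreeGroup.lift f)) (hrel : ∀ r ∈ R, FreeGroup.lift f r = 1)
    (hquot : ∀ M : ProPIndex p X, R ⊆ M.sub →
      ∃ θ : G →ₜ* M.Quot, ∀ x, θ (f x) = M.proj (FreeGroup.of x)) :
    ∃ e : ProPPresented p R ≃ₜ* G, ∀ x, e (ProPPresented.of p R x) = f x := by
  obtain ⟨Φ, hΦ⟩ := FreeProP.exists_lift hG hf
  have hker := relatorSubgroup_eq_ker hΦ hrel hquot
  have hsurj : Function.Surjective Φ := by
    have hrange : Set.range (FreeGroup.lift f) ⊆ Set.range Φ := by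
      rintro _ ⟨w, rfl⟩
      exact ⟨_, hΦ w⟩
    exact Set.range_eq_univ.1 ((isCompact_range Φ.continuous_toFun).isClosed.closure_eq ▸
      (hdense.mono hrange).closure_eq)
  let Ψ : ProPPresented p R →ₜ* G :=
    { QuotientGroup.lift (relatorSubgroup p R) Φ.toMonoidHom hker.le with
      continuous_toFun := Φ.continuous_toFun.quotient_lift _ }
  have hinj : Function.Injective Ψ := (QuotientGroup.injective_lift_iff _ _ hker.le).2 hker
  have hsurj' : Function.Surjective Ψ := fun g => (hsurj g).imp' QuotientGroup.mk fun _ h => h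
  exact ⟨continuousMulEquivOfBijective Ψ ⟨hinj, hsurj'⟩,
    fun x => (hΦ (FreeGroup.of x)).trans (FreeGroup.lift_apply_of)⟩

end Presentation

section PadicPow

variable {p : ℕ} [Fact p.Prime] {M : Type*} [Monoid M] {n : ℕ} {q : M}

/-- `q ^ x` for a `p`-adic integer `x` and an element `q` with `q ^ p ^ n = 1`. -/
noncomputable def padicPow {p : ℕ} [Fact p.Prime] {M : Type*} [Monoid M] (n : ℕ) (q : M)
    (x : ℤ_[p]) : M :=
  q ^ (PadicInt.toZModPow n x).val

theorem padicPow_eq_pow (hq : q ^ p ^ n = 1) {x : ℤ_[p]} {j : ℕ}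
    (h : PadicInt.toZModPow n x = j) : padicPow n q x = q ^ j := by
  rw [padicPow, h, ZMod.val_natCast]
  exact pow_eq_pow_of_modEq (Nat.mod_modEq _ _) hq

theorem padicPow_natCast (hq : q ^ p ^ n = 1) (j : ℕ) : padicPow n q (j : ℤ_[p]) = q ^ j :=
  padicPow_eq_pow hq (map_natCast _ _)

theorem padicPow_one (hq : q ^ p ^ n = 1) : padicPow n q (1 : ℤ_[p]) = q := by
  simpa using padicPow_natCast (p := p) hq 1

theorem padicPow_zero : padicPow n q (0 : ℤ_[p]) = 1 := by
  simp [padicPow]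

theorem padicPow_add (hq : q ^ p ^ n = 1) (x y : ℤ_[p]) :
    padicPow n q (x + y) = padicPow n q x * padicPow n q y := by
  rw [padicPow_eq_pow hq (j := (PadicInt.toZModPow n x).val + (PadicInt.toZModPow n y).val)]
  · exact pow_add _ _ _
  · simp

theorem padicPow_mul (hq : q ^ p ^ n = 1) (x y : ℤ_[p]) :
    padicPow n q (x * y) = padicPow n (padicPow n q x) y := by
  rw [padicPow_eq_pow hq (j := (PadicInt.toZModPow n x).val * (PadicInt.toZModPow n y).val)]
  · exact pow_mul _ _ _
  · simp

theorem map_padicPow {N E : Type*} [Monoid N] [FunLike E M N] [MonoidHomClass E M N] (φ : E)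
    (x : ℤ_[p]) : φ (padicPow n q x) = padicPow n (φ q) x :=
  map_pow φ q _

theorem continuous_padicPow [TopologicalSpace M] (n : ℕ) (q : M) :
    Continuous (padicPow n q : ℤ_[p] → M) :=
  (continuous_of_discreteTopology (f := fun c : ZMod (p ^ n) => q ^ c.val)).comp
    (continuous_toZModPow n)

/-- The homomorphism `x ↦ q ^ x` from `ℤ_p` to a monoid in which `q ^ p ^ n = 1`. -/
noncomputable def padicPowHom (hq : q ^ p ^ n = 1) : Multiplicative ℤ_[p] →* M where
  toFun x := padicPow n q x.toAdd
  map_one' := padicPow_zero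
  map_mul' _ _ := padicPow_add hq _ _

end PadicPow

section RootSystem

variable {p : ℕ} [Fact p.Prime]

theorem pow_pow_add_of_succ_pow_eq {p : ℕ} {M : Type*} [Monoid M] {u : ℕ → M}
    (hu : ∀ n, u (n + 1) ^ p = u n) (n m : ℕ) : u (n + m) ^ p ^ m = u n := by
  induction m with
  | zero => rw [add_zero, pow_zero, pow_one]
  | succ m ih => rw [← add_assoc, pow_succ', pow_mul, hu, ih]

theorem exists_padicPow_eq {K : Type*} [CommRing K] [IsDomain K] {ζ : ℕ → K}
    (hprim : ∀ n, IsPrimitiveRoot (ζ n) (p ^ n)) (hζ : ∀ n, ζ (n + 1) ^ p = ζ n)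
    {u : ℕ → K} (hu0 : u 0 = 1) (hu : ∀ n, u (n + 1) ^ p = u n) :
    ∃ x : ℤ_[p], ∀ n, u n = padicPow n (ζ n) x := by
  have hpn (n : ℕ) : p ^ n ≠ 0 := pow_ne_zero _ (Fact.out : p.Prime).ne_zero
  have hex (n : ℕ) : ∃ j : ℕ, ζ n ^ j = u n := by
    have : NeZero (p ^ n) := ⟨hpn n⟩
    have hun : u n ^ p ^ n = 1 := by rw [← hu0, ← pow_pow_add_of_succ_pow_eq hu 0 n, zero_add]
    obtain ⟨j, -, hj⟩ := (hprim n).eq_pow_of_pow_eq_one hun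
    exact ⟨j, hj⟩
  choose j hj using hex
  have hdvd (n : ℕ) : ((p : ℤ)) ^ n ∣ (j (n + 1) : ℤ) - (j n : ℤ) := by
    have h1 : ζ n ^ j (n + 1) = ζ n ^ j n := by
      rw [hj, ← hu, ← hj, ← hζ, ← pow_mul, ← pow_mul, mul_comm]
    rw [((hprim n).isOfFinOrder (hpn n)).pow_eq_pow_iff_modEq, ← (hprim n).eq_orderOf] at h1
    rw [← Nat.cast_pow]
    exact Nat.modEq_iff_dvd.1 h1.symm
  refine ⟨PadicInt.ofIntSeq _
    (PadicInt.isCauSeq_padicNorm_of_pow_dvd_sub (fun n => (j n : ℤ)) p hdvd), fun n => ?_⟩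
  rw [← hj]
  refine (padicPow_eq_pow (hprim n).pow_eq_one ?_).symm
  rw [PadicInt.toZModPow_ofIntSeq_of_pow_dvd_sub _ p hdvd n]
  simp

theorem padicPow_injective {M : Type*} [CommMonoid M] {ζ : ℕ → M}
    (hprim : ∀ n, IsPrimitiveRoot (ζ n) (p ^ n)) {x y : ℤ_[p]}
    (h : ∀ n, padicPow n (ζ n) x = padicPow n (ζ n) y) : x = y := by
  refine PadicInt.ext_of_toZModPow.1 fun n => ?_
  have : NeZero (p ^ n) := ⟨pow_ne_zero _ (Fact.out : p.Prime).ne_zero⟩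
  exact ZMod.val_injective _ ((hprim n).pow_inj (ZMod.val_lt _) (ZMod.val_lt _) (h n))

end RootSystem

section Quotients

variable {p : ℕ} [Fact p.Prime] {I Q : Type*} [Group Q] [TopologicalSpace Q]

open Classical in
theorem monoidHom_ext_pi_single [T2Space Q] {f g : Multiplicative (I → ℤ_[p]) →* Q}
    (hf : Continuous f) (hg : Continuous g)
    (h : ∀ i, f (Multiplicative.ofAdd (Pi.single i 1)) = g (Multiplicative.ofAdd (Pi.single i 1))) :
    f = g := by
  have htop : Subgroup.toAddSubgroup' (f.eqLocus g) = ⊤ :=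
    pi_padicInt_eq_top_of_single_mem
      (isClosed_eq (hf.comp continuous_ofAdd) (hg.comp continuous_ofAdd)) h
  exact MonoidHom.ext fun v => (AddSubgroup.eq_top_iff' _).1 htop v.toAdd

variable {n : ℕ} {t : I → Q}

open Classical in
theorem exists_continuousMonoidHom_pi (hn : ∀ i, t i ^ p ^ n = 1)
    (hcomm : ∀ i j, Commute (t i) (t j)) (hfin : {i | t i ≠ 1}.Finite) :
    ∃ f : Multiplicative (I → ℤ_[p]) →ₜ* Q,
      ∀ i x, f (Multiplicative.ofAdd (Pi.single i x)) = padicPow n (t i) x := by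
  let S := hfin.toFinset
  let f : (S → Multiplicative ℤ_[p]) →* Q :=
    MonoidHom.noncommPiCoprod (fun i : S => padicPowHom (hn i))
      fun i j _ _ _ => (hcomm i j).pow_pow _ _
  let restrict : Multiplicative (I → ℤ_[p]) →* (S → Multiplicative ℤ_[p]) :=
    { toFun v i := Multiplicative.ofAdd (v.toAdd i)
      map_one' := rfl
      map_mul' _ _ := rfl }
  let F (c : S → ZMod (p ^ n)) : Q := Finset.univ.noncommProd (fun i => t i.1 ^ (c i).val)
    fun i _ j _ _ => (hcomm i j).pow_pow _ _
  have hcont : Continuous (f.comp restrict) :=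
    (continuous_of_discreteTopology (f := F)).comp <| continuous_pi fun i : S =>
      (continuous_toZModPow n).comp ((continuous_apply i.1).comp continuous_toAdd)
  refine ⟨⟨f.comp restrict, hcont⟩, fun i x => ?_⟩
  change f (restrict _) = _
  by_cases hi : i ∈ S
  · have hrestrict : restrict (Multiplicative.ofAdd (Pi.single i x)) =
        Pi.mulSingle (⟨i, hi⟩ : S) (Multiplicative.ofAdd x) := by
      ext j
      rcases eq_or_ne j ⟨i, hi⟩ with rfl | hj
      · simp [restrict]
      · simp [restrict, hj, Subtype.ext_iff.not.1 hj]
    rw [hrestrict]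
    exact MonoidHom.noncommPiCoprod_mulSingle _ _ _
  · have hrestrict : restrict (Multiplicative.ofAdd (Pi.single i x)) = 1 := by
      ext j
      have hj : j.1 ≠ i := fun h => hi (h ▸ j.2)
      simp [restrict, hj]
    have hti : t i = 1 := by simpa [S] using hi
    rw [hrestrict, map_one, hti, padicPow, one_pow]

variable [DiscreteTopology Q]

theorem padicPow_onePlusPow {k : ℕ} (hk : 1 ≤ k) {s t : Q} (hs : s ^ p ^ n = 1)
    (ht : t ^ p ^ n = 1) (hrel : s * t * s⁻¹ = t * t ^ p ^ k) (z : ℤ_[p]) :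
    padicPow n t (onePlusPow p k hk z) = padicPow n s z * t * (padicPow n s z)⁻¹ := by
  refine PadicInt.denseRange_natCast.induction_on z (isClosed_eq ?_ ?_) fun m => ?_
  · exact (continuous_padicPow n t).comp (continuous_onePlusPow hk)
  · exact (continuous_of_discreteTopology (f := fun q => q * t * q⁻¹)).comp
      (continuous_padicPow n s)
  have hone : padicPow n t (1 + (p : ℤ_[p]) ^ k) = s * t * s⁻¹ := by
    have h := padicPow_natCast (p := p) ht (1 + p ^ k)
    push_cast at h
    rw [h, hrel, pow_add, pow_one]
  rw [padicPow_natCast hs, onePlusPow_natCast, ← MulAut.conj_apply]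
  induction m with
  | zero => simp [padicPow_one ht]
  | succ m ih =>
    rw [pow_succ', padicPow_mul ht, hone, ← MulAut.conj_apply, ← map_padicPow, ih,
      ← MulAut.mul_apply, ← map_mul, pow_succ']

theorem exists_continuousMonoidHom_crSemidirect {k : ℕ} (hk : 1 ≤ k) {s : Q}
    (hQ : ∀ q : Q, q ^ p ^ n = 1) (hcomm : ∀ i j, Commute (t i) (t j))
    (hfin : {i | t i ≠ 1}.Finite) (hrel : ∀ i, s * t i * s⁻¹ = t i * t i ^ p ^ k) :
    ∃ θ : CRSemidirect p k hk I →ₜ* Q, ∀ j, θ (crGen p k hk I j) = j.elim s t := by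
  classical
  obtain ⟨f, hf⟩ := exists_continuousMonoidHom_pi (p := p) (fun i => hQ (t i)) hcomm hfin
  let g := padicPowHom (p := p) (hQ s)
  have hcompat (z : Multiplicative ℤ_[p]) :
      f.toMonoidHom.comp (crAction p k hk I z).toMonoidHom =
        (MulAut.conj (g z)).toMonoidHom.comp f.toMonoidHom := by
    refine monoidHom_ext_pi_single ?_ ?_ fun i => ?_
    · exact f.continuous_toFun.comp
        (continuous_crAction.comp (continuous_const.prodMk continuous_id))
    · exact (continuous_of_discreteTopology (f := MulAut.conj (g z))).comp f.continuous_toFun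
    · change f (Multiplicative.ofAdd (onePlusPow p k hk z.toAdd • Pi.single i 1)) =
        padicPow n s z.toAdd * f (Multiplicative.ofAdd (Pi.single i 1)) * (padicPow n s z.toAdd)⁻¹
      rw [← Pi.single_smul, smul_eq_mul, mul_one, hf, hf, padicPow_one (hQ _),
        padicPow_onePlusPow hk (hQ s) (hQ _) (hrel i)]
  let θ := SemidirectProduct.lift f.toMonoidHom g hcompat
  have hθ : Continuous θ := (f.continuous_toFun.comp continuous_left).mul
    ((continuous_padicPow n s).comp (continuous_toAdd.comp continuous_right))
  refine ⟨⟨θ, hθ⟩, ?_⟩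
  rintro (_ | i)
  · exact (SemidirectProduct.lift_inr _ _ hcompat _).trans (padicPow_one (hQ s))
  · exact (SemidirectProduct.lift_inl _ _ hcompat _).trans ((hf i 1).trans (padicPow_one (hQ _)))

theorem exists_crPresented_equiv (p k : ℕ) [Fact p.Prime] (hk : 1 ≤ k) (I : Type*) :
    ∃ e : ProPPresented p (crRelators p k I) ≃ₜ* CRSemidirect p k hk I,
      ∀ j, e (ProPPresented.of p _ j) = crGen p k hk I j := by
  refine exists_proPPresented_equiv isProP_crSemidirect tendsto_crGen denseRange_lift_crGen
    (fun r hr => lift_crGen_crRelators hr) fun M hM => ?_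
  obtain ⟨n, hn⟩ := M.exists_pow_eq_one
  have hcomm (i j : I) : Commute (M.proj (tauWord i)) (M.proj (tauWord j)) := by
    rw [← commutatorElement_eq_one_iff_commute, ← map_commutatorElement]
    exact ProPIndex.proj_eq_one.2 (hM (Or.inl ⟨i, j, rfl⟩))
  have hrel (i : I) : M.proj (sigmaWord I) * M.proj (tauWord i) * (M.proj (sigmaWord I))⁻¹ =
      M.proj (tauWord i) * M.proj (tauWord i) ^ p ^ k := by
    have h := ProPIndex.proj_eq_one.2 (hM (Or.inr ⟨i, rfl⟩))
    rw [map_mul, map_commutatorElement, map_inv, map_pow, mul_inv_eq_one, commutatorElement_def,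
      mul_inv_eq_iff_eq_mul] at h
    rw [h, ← pow_succ, ← pow_succ']
  have hfin : {i | M.proj (tauWord i) ≠ 1}.Finite := by
    have h := M.cofinite.preimage (f := some) (Option.some_injective I).injOn
    exact h.subset fun i hi => mt ProPIndex.proj_eq_one.2 hi
  obtain ⟨θ, hθ⟩ := exists_continuousMonoidHom_crSemidirect hk hn hcomm hfin hrel
  refine ⟨θ, fun j => (hθ j).trans ?_⟩
  cases j <;> rfl

end Quotients

section ModN

variable {G J : Type*} [CommGroup G] {n : ℕ}

theorem mkQ_ofMul_eq_zero_iff {x : G} : ModN.mkQ n (Additive.ofMul x) = 0 ↔ ∃ y, x = y ^ n := by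
  refine (Submodule.Quotient.mk_eq_zero
    (LinearMap.range (LinearMap.lsmul ℤ (Additive G) (n : ℤ)))).trans ?_
  rw [LinearMap.mem_range, Additive.exists]
  refine exists_congr fun y => ?_
  rw [LinearMap.lsmul_apply, natCast_zsmul, ← ofMul_pow, Additive.ofMul.injective.eq_iff, eq_comm]

theorem mkQ_ofMul_surjective (x : ModN (Additive G) n) :
    ∃ y : G, ModN.mkQ n (Additive.ofMul y) = x := by
  obtain ⟨y, hy⟩ := Submodule.mkQ_surjective _ x
  exact ⟨y.toMul, hy⟩

theorem mkQ_ofMul_prod_pow (S : Finset J) (g : J → G) (c : J → ℕ) :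
    ModN.mkQ n (Additive.ofMul (∏ j ∈ S, g j ^ c j)) =
      ∑ j ∈ S, (c j : ZMod n) • ModN.mkQ n (Additive.ofMul (g j)) := by
  rw [ofMul_prod, map_sum]
  refine Finset.sum_congr rfl fun j _ => ?_
  rw [ofMul_pow, map_nsmul, Nat.cast_smul_eq_nsmul]

variable {g : J → G} (b : Module.Basis J (ZMod n) (ModN (Additive G) n))
  (hg : ∀ j, b j = ModN.mkQ n (Additive.ofMul (g j)))

include hg

theorem exists_eq_prod_pow_mul_pow [NeZero n] (x : G) :
    ∃ (S : Finset J) (c : J → ℕ) (y : G), x = (∏ j ∈ S, g j ^ c j) * y ^ n := by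
  let r := b.repr (ModN.mkQ n (Additive.ofMul x))
  have hr : ModN.mkQ n (Additive.ofMul x) =
      ModN.mkQ n (Additive.ofMul (∏ j ∈ r.support, g j ^ (r j).val)) := by
    rw [mkQ_ofMul_prod_pow, ← b.linearCombination_repr (ModN.mkQ n (Additive.ofMul x)),
      Finsupp.linearCombination_apply, Finsupp.sum]
    exact Finset.sum_congr rfl fun j _ => by rw [ZMod.natCast_zmod_val, hg]
  rw [← sub_eq_zero, ← map_sub, ← ofMul_div, mkQ_ofMul_eq_zero_iff] at hr
  obtain ⟨y, hy⟩ := hr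
  exact ⟨r.support, fun j => (r j).val, y, by rw [← hy, mul_div_cancel]⟩

theorem natCast_eq_zero_of_prod_pow_eq_pow {S : Finset J} {c : J → ℕ} {y : G}
    (h : ∏ j ∈ S, g j ^ c j = y ^ n) : ∀ j ∈ S, (c j : ZMod n) = 0 := by
  have hsum := mkQ_ofMul_eq_zero_iff.2 ⟨y, h⟩
  simp only [mkQ_ofMul_prod_pow, ← hg] at hsum
  exact linearIndependent_iff'.1 b.linearIndependent S _ hsum

end ModN

section Galois

/-- The elements of `K` having a `p`-power power in `Fˣ`. -/
def radicals (p : ℕ) (F K : Type*) [Field F] [Field K] [Algebra F K] : Set K :=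
  {x | ∃ (m : ℕ) (c : Fˣ), x ^ p ^ m = algebraMap F K c}

/-- Compatible systems of `p`-power roots of unity `zeta n` and of `p`-power roots `root j n` of
representatives `gen j` of a basis of `Fˣ / (Fˣ) ^ p`, in a field `K` generated over `F` by
`p`-power radicals. The index `none` stands for the basis vector `ζ_{p^k}`, whose roots are
roots of unity. -/
structure RadicalSystem (p k : ℕ) (I F K : Type*) [Field F] [Field K] [Algebra F K] where
  gen : Option I → Fˣ
  basis : Module.Basis (Option I) (ZMod p) (ModN (Additive Fˣ) p)
  basis_apply : ∀ j, basis j = ModN.mkQ p (Additive.ofMul (gen j))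
  root : Option I → ℕ → K
  root_zero : ∀ j, root j 0 = algebraMap F K (gen j)
  root_succ : ∀ j n, root j (n + 1) ^ p = root j n
  zeta : ℕ → K
  isPrimitiveRoot : ∀ n, IsPrimitiveRoot (zeta n) (p ^ n)
  zeta_succ : ∀ n, zeta (n + 1) ^ p = zeta n
  zeta_add : ∀ n, zeta (k + n) = root none n
  adjoin_radicals : IntermediateField.adjoin F (radicals p F K) = ⊤

-- `(1 + p ^ k) ^ z ≡ 1 + z * p ^ k` modulo `p ^ (k + 1)`.
theorem padicPow_succ_onePlusPow {p k : ℕ} [Fact p.Prime] {M : Type*} [CommMonoid M] (hk : 1 ≤ k)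
    {q : M} (hq : q ^ p ^ (k + 1) = 1) (z : ℤ_[p]) :
    padicPow (k + 1) q (onePlusPow p k hk z) = padicPow 1 (q ^ p ^ k) z * q := by
  have hω : (q ^ p ^ k) ^ p = 1 := by rw [← pow_mul, ← pow_succ, hq]
  let _ : TopologicalSpace M := ⊥
  have : DiscreteTopology M := ⟨rfl⟩
  refine PadicInt.denseRange_natCast.induction_on z (isClosed_eq ?_ ?_) fun n => ?_
  · exact (continuous_padicPow _ _).comp (continuous_onePlusPow hk)
  · exact (continuous_of_discreteTopology (f := (· * q))).comp (continuous_padicPow _ _)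
  rw [onePlusPow_natCast, padicPow_natCast (by rwa [pow_one])]
  induction n with
  | zero => rw [pow_zero, pow_zero, one_mul, padicPow_one hq]
  | succ n ih =>
    have hone : (1 + (p : ℤ_[p]) ^ k) = ((1 + p ^ k : ℕ) : ℤ_[p]) := by push_cast; rfl
    have hωk : (q ^ p ^ k) ^ p ^ k = 1 := by
      rw [← pow_mul, ← pow_add, show k + k = k + 1 + (k - 1) by omega, pow_add, pow_mul, hq,
        one_pow]
    rw [pow_succ, padicPow_mul hq, ih, hone, padicPow_natCast]
    · rw [pow_add, pow_one, mul_pow, pow_right_comm _ n, hωk, one_pow, one_mul, pow_succ]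
      exact mul_right_comm _ _ _
    · rw [mul_pow, hq, mul_one, pow_right_comm, pow_succ, mul_comm, pow_mul _ p, hω, one_pow,
        one_pow]

namespace RadicalSystem

variable {p k : ℕ} {I F K : Type*} [Field F] [Field K] [Algebra F K]
  (R : RadicalSystem p k I F K)

theorem zeta_pow (n : ℕ) : R.zeta n ^ p ^ n = 1 := (R.isPrimitiveRoot n).pow_eq_one

theorem root_pow (j : Option I) (n : ℕ) : R.root j n ^ p ^ n = algebraMap F K (R.gen j) := by
  rw [← R.root_zero, ← pow_pow_add_of_succ_pow_eq (R.root_succ j) 0 n, zero_add]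

theorem zeta_eq_gen_none : R.zeta k = algebraMap F K (R.gen none) := by
  rw [← R.root_zero, ← R.zeta_add, add_zero]

theorem zeta_one_eq_gen_none_pow (hk : 1 ≤ k) :
    R.zeta 1 = algebraMap F K (R.gen none ^ p ^ (k - 1) : Fˣ) := by
  rw [Units.val_pow_eq_pow_val, map_pow, ← R.zeta_eq_gen_none,
    ← pow_pow_add_of_succ_pow_eq R.zeta_succ 1 (k - 1), Nat.add_sub_cancel' hk]

theorem prod_root_pow_pow (S : Finset (Option I)) (c : Option I → ℕ) (n : ℕ) :
    (∏ j ∈ S, R.root j n ^ c j) ^ p ^ n = algebraMap F K (∏ j ∈ S, R.gen j ^ c j : Fˣ) := by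
  simp only [← Finset.prod_pow, Units.coe_prod, Units.val_pow_eq_pow_val, map_prod, map_pow,
    ← R.root_pow _ n, pow_right_comm]

variable [hp : Fact p.Prime]

include hp in
theorem root_ne_zero (j : Option I) (n : ℕ) : R.root j n ≠ 0 :=
  ne_zero_pow (pow_ne_zero n hp.out.ne_zero) <| R.root_pow j n ▸
    (map_ne_zero (algebraMap F K)).2 (R.gen j).ne_zero

include hp in
theorem prod_root_pow_ne_zero (S : Finset (Option I)) (c : Option I → ℕ) (n : ℕ) :
    ∏ j ∈ S, R.root j n ^ c j ≠ 0 :=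
  Finset.prod_ne_zero_iff.2 fun j _ => pow_ne_zero _ (R.root_ne_zero j n)

include hp R in
theorem exists_eq_algebraMap_of_pow_eq (hk : 1 ≤ k) {x : K} {y : Fˣ}
    (h : x ^ p = algebraMap F K y ^ p) : ∃ c : Fˣ, x = algebraMap F K c := by
  have hy : algebraMap F K y ≠ 0 := (map_ne_zero _).2 y.ne_zero
  have hζ : IsPrimitiveRoot (R.zeta 1) p := by simpa using R.isPrimitiveRoot 1
  have hroot : (x / algebraMap F K y) ^ p = 1 := by rw [div_pow, h, div_self (pow_ne_zero _ hy)]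
  have : NeZero p := ⟨hp.out.ne_zero⟩
  obtain ⟨i, -, hi⟩ := hζ.eq_pow_of_pow_eq_one hroot
  refine ⟨(R.gen none ^ p ^ (k - 1)) ^ i * y, ?_⟩
  rw [Units.val_mul, map_mul, Units.val_pow_eq_pow_val (_ ^ _), map_pow,
    ← R.zeta_one_eq_gen_none_pow hk, hi, div_mul_cancel₀ _ hy]

include hp in
theorem eq_top_of_root_mem (hk : 1 ≤ k) {E : IntermediateField F K}
    (hE : ∀ j n, R.root j n ∈ E) : E = ⊤ := by
  rw [eq_top_iff, ← R.adjoin_radicals, IntermediateField.adjoin_le_iff]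
  rintro x ⟨m, c, hx⟩
  induction m generalizing x c with
  | zero =>
    rw [pow_zero, pow_one] at hx
    exact hx ▸ E.algebraMap_mem _
  | succ m ih =>
    have : NeZero p := ⟨hp.out.ne_zero⟩
    obtain ⟨S, e, y, rfl⟩ := exists_eq_prod_pow_mul_pow R.basis R.basis_apply c
    let δ := ∏ j ∈ S, R.root j (m + 1) ^ e j
    have hδ : δ ≠ 0 := R.prod_root_pow_ne_zero S e (m + 1)
    have hdiv : ((x / δ) ^ p ^ m) ^ p = algebraMap F K y ^ p := by
      rw [← pow_mul, ← pow_succ, div_pow, hx, Units.val_mul, map_mul, ← R.prod_root_pow_pow,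
        mul_div_cancel_left₀ _ (pow_ne_zero _ hδ), Units.val_pow_eq_pow_val, map_pow]
    obtain ⟨d, hd⟩ := R.exists_eq_algebraMap_of_pow_eq hk hdiv
    have hmem := E.mul_mem (ih d hd)
      (prod_mem fun j (_ : j ∈ S) => pow_mem (hE j (m + 1)) (e j))
    rwa [div_mul_cancel₀ _ hδ] at hmem

include hp in
theorem galois_ext (hk : 1 ≤ k) {s t : Gal(K/F)} (h : ∀ j n, s (R.root j n) = t (R.root j n)) :
    s = t := by
  let E : IntermediateField F K :=
    { AlgHom.equalizer s.toAlgHom t.toAlgHom with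
      inv_mem' := fun x (hx : s x = t x) => by
        change s x⁻¹ = t x⁻¹
        rw [map_inv₀, map_inv₀, hx] }
  have hE : E = ⊤ := R.eq_top_of_root_mem hk h
  exact AlgEquiv.ext fun x => (hE ▸ IntermediateField.mem_top : x ∈ E)

/-- `s` acts on the radicals of the system as `g` prescribes: `s ζ = ζ ^ ((1 + p ^ k) ^ z)` and
`s (root i n) = (zeta n) ^ (v i) * root i n` if `g = (v, z)`. -/
def ActsAs (hk : 1 ≤ k) (s : Gal(K/F)) (g : CRSemidirect p k hk I) : Prop :=
  (∀ n, s (R.zeta n) = padicPow n (R.zeta n) (onePlusPow p k hk g.right.toAdd)) ∧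
    ∀ i n, s (R.root (some i) n) = padicPow n (R.zeta n) (g.left.toAdd i) * R.root (some i) n

variable {R} {hk : 1 ≤ k} {s t : Gal(K/F)} {g h : CRSemidirect p k hk I}

theorem ActsAs.mul (hs : R.ActsAs hk s g) (ht : R.ActsAs hk t h) :
    R.ActsAs hk (s * t) (g * h) := by
  refine ⟨fun n => ?_, fun i n => ?_⟩
  · rw [AlgEquiv.mul_apply, ht.1, map_padicPow, hs.1, ← padicPow_mul (R.zeta_pow n),
      ← AddChar.map_add_eq_mul]
    rfl
  · rw [AlgEquiv.mul_apply, ht.2, map_mul, map_padicPow, hs.1, hs.2, ← padicPow_mul (R.zeta_pow n),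
      ← mul_assoc, ← padicPow_add (R.zeta_pow n), add_comm]
    rfl

theorem isClosed_setOf_actsAs [Algebra.IsIntegral F K] :
    IsClosed {x : Gal(K/F) × CRSemidirect p k hk I | R.ActsAs hk x.1 x.2} := by
  let _ : TopologicalSpace K := ⊥
  have : DiscreteTopology K := ⟨rfl⟩
  have : ContinuousSMul Gal(K/F) K :=
    continuousSMul_iff_stabilizer_isOpen.2 stabilizer_isOpen_of_isIntegral
  have happly (x : K) : Continuous fun y : Gal(K/F) × CRSemidirect p k hk I => y.1 x :=
    continuous_fst.smul continuous_const
  simp only [ActsAs, Set.ofPred_and, Set.ofPred_forall]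
  refine .inter (isClosed_iInter fun n => isClosed_eq (happly _) ?_)
    (isClosed_iInter fun i => isClosed_iInter fun n => isClosed_eq (happly _) ?_)
  · exact (continuous_padicPow n _).comp <| (continuous_onePlusPow hk).comp <|
      (continuous_crCoord none).comp continuous_snd
  · exact ((continuous_padicPow n _).comp <|
      (continuous_crCoord (some i)).comp continuous_snd).mul continuous_const

theorem ActsAs.apply_zeta_succ (hs : R.ActsAs hk s g) : s (R.zeta (k + 1)) =
    padicPow 1 (R.zeta 1) g.right.toAdd * R.zeta (k + 1) := by
  rw [hs.1, padicPow_succ_onePlusPow hk (R.zeta_pow (k + 1)), add_comm k 1,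
    pow_pow_add_of_succ_pow_eq R.zeta_succ 1 k]

theorem ActsAs.apply_root_one (hs : R.ActsAs hk s g) (j : Option I) :
    s (R.root j 1) = padicPow 1 (R.zeta 1) (crCoord j g) * R.root j 1 := by
  cases j with
  | none => exact R.zeta_add 1 ▸ hs.apply_zeta_succ
  | some i => exact hs.2 i 1

theorem ActsAs.eq_one (hs : R.ActsAs hk s 1) : s = 1 := by
  have hzeta (n : ℕ) : s (R.zeta n) = R.zeta n := by
    rw [hs.1, SemidirectProduct.one_right, toAdd_one, AddChar.map_zero_eq_one,
      padicPow_one (R.zeta_pow n)]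
  refine R.galois_ext hk fun j n => ?_
  cases j with
  | none => exact R.zeta_add n ▸ hzeta (k + n)
  | some i =>
    rw [hs.2, SemidirectProduct.one_left, toAdd_one, Pi.zero_apply, padicPow_zero, one_mul,
      AlgEquiv.one_apply]

theorem exists_apply_zeta_eq (R : RadicalSystem p k I F K) (h2 : p = 2 → 2 ≤ k) (hk : 1 ≤ k)
    (s : Gal(K/F)) :
    ∃ z, ∀ n, s (R.zeta n) = padicPow n (R.zeta n) (onePlusPow p k hk z) := by
  obtain ⟨u, hu⟩ := exists_padicPow_eq R.isPrimitiveRoot R.zeta_succ (u := fun n => s (R.zeta n))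
    (by simpa using congrArg s (R.zeta_pow 0)) fun n => by rw [← map_pow, R.zeta_succ]
  have hfix : padicPow k (R.zeta k) u = padicPow k (R.zeta k) (1 : ℤ_[p]) := by
    rw [← hu, padicPow_one (R.zeta_pow k), R.zeta_eq_gen_none, s.commutes]
  have hu1 : (p : ℤ_[p]) ^ k ∣ u - 1 := by
    have : NeZero (p ^ k) := ⟨pow_ne_zero _ hp.out.ne_zero⟩
    rw [← toZModPow_eq_zero_iff, map_sub, sub_eq_zero]
    exact ZMod.val_injective _ ((R.isPrimitiveRoot k).pow_inj (ZMod.val_lt _) (ZMod.val_lt _) hfix)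
  obtain ⟨z, rfl⟩ := exists_onePlusPow_eq hk h2 hu1
  exact ⟨z, hu⟩

theorem exists_apply_root_eq (R : RadicalSystem p k I F K) (s : Gal(K/F)) (j : Option I) :
    ∃ v : ℤ_[p], ∀ n, s (R.root j n) = padicPow n (R.zeta n) v * R.root j n := by
  obtain ⟨v, hv⟩ := exists_padicPow_eq R.isPrimitiveRoot R.zeta_succ
    (u := fun n => s (R.root j n) / R.root j n)
    (by rw [R.root_zero, s.commutes, ← R.root_zero, div_self (R.root_ne_zero j 0)])
    fun n => by rw [div_pow, ← map_pow, R.root_succ]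
  exact ⟨v, fun n => by rw [← hv, div_mul_cancel₀ _ (R.root_ne_zero j n)]⟩

theorem existsUnique_actsAs (R : RadicalSystem p k I F K) (h2 : p = 2 → 2 ≤ k) (hk : 1 ≤ k)
    (s : Gal(K/F)) : ∃! g, R.ActsAs hk s g := by
  obtain ⟨z, hz⟩ := R.exists_apply_zeta_eq h2 hk s
  choose v hv using fun i => R.exists_apply_root_eq s (some i)
  refine ⟨⟨Multiplicative.ofAdd v, Multiplicative.ofAdd z⟩, ⟨hz, hv⟩, fun g hg => ?_⟩
  refine SemidirectProduct.ext (funext fun i : I => ?_) ?_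
  · refine padicPow_injective (p := p) R.isPrimitiveRoot fun n => ?_
    exact mul_right_cancel₀ (R.root_ne_zero (some i) n) ((hg.2 i n).symm.trans (hv i n))
  · refine onePlusPow_injective (p := p) hk h2 (padicPow_injective R.isPrimitiveRoot fun n => ?_)
    exact (hg.1 n).symm.trans (hz n)

theorem ActsAs.apply_prod_root_one (hs : R.ActsAs hk s g) {S : Finset (Option I)}
    {c : Option I → ZMod p} (hc : ∑ j ∈ S, c j * PadicInt.toZMod (crCoord j g) = 0) :
    s (∏ j ∈ S, R.root j 1 ^ (c j).val) = ∏ j ∈ S, R.root j 1 ^ (c j).val := by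
  have : NeZero p := ⟨hp.out.ne_zero⟩
  have hdvd : p ∣ ∑ j ∈ S, (PadicInt.toZModPow 1 (crCoord j g)).val * (c j).val := by
    rw [← ZMod.natCast_eq_zero_iff, ← hc]
    push_cast [natCast_val_toZModPow_one, ZMod.natCast_zmod_val]
    exact Finset.sum_congr rfl fun j _ => mul_comm _ _
  have hζ : R.zeta 1 ^ p = 1 := by simpa using R.zeta_pow 1
  simp only [map_prod, map_pow, hs.apply_root_one, mul_pow, Finset.prod_mul_distrib, padicPow,
    ← pow_mul, Finset.prod_pow_eq_pow_sum]
  obtain ⟨r, hr⟩ := hdvd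
  rw [hr, pow_mul, hζ, one_pow, one_mul]

theorem eq_zero_of_sum_mul_crCoord_eq_zero [IsGalois F K] (R : RadicalSystem p k I F K)
    {S : Finset (Option I)} {c : Option I → ZMod p}
    (h : ∀ s : Gal(K/F), ∃ g, R.ActsAs hk s g ∧
      ∑ j ∈ S, c j * PadicInt.toZMod (crCoord j g) = 0) : ∀ j ∈ S, c j = 0 := by
  have : NeZero p := ⟨hp.out.ne_zero⟩
  have hfix (s : Gal(K/F)) :
      s (∏ j ∈ S, R.root j 1 ^ (c j).val) = ∏ j ∈ S, R.root j 1 ^ (c j).val := by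
    obtain ⟨g, hg, hsum⟩ := h s
    exact hg.apply_prod_root_one hsum
  obtain ⟨b, hb⟩ := (InfiniteGalois.mem_range_algebraMap_iff_fixed _).2 hfix
  have hb0 : b ≠ 0 :=
    (map_ne_zero (algebraMap F K)).1 (hb ▸ R.prod_root_pow_ne_zero S _ 1)
  have hprod : ∏ j ∈ S, R.gen j ^ (c j).val = Units.mk0 b hb0 ^ p := by
    refine Units.ext ((algebraMap F K).injective ?_)
    rw [← R.prod_root_pow_pow S _ 1, ← hb, Units.val_pow_eq_pow_val, Units.val_mk0, map_pow,
      pow_one]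
  intro j hj
  rw [← ZMod.natCast_zmod_val (c j)]
  exact natCast_eq_zero_of_prod_pow_eq_pow R.basis R.basis_apply hprod j hj

theorem surjective_of_actsAs [IsGalois F K] {φ : Gal(K/F) →ₜ* CRSemidirect p k hk I}
    (hφ : ∀ s, R.ActsAs hk s (φ s)) : Function.Surjective φ := by
  by_contra hsurj
  have hne : φ.toMonoidHom.range ≠ ⊤ := fun h => hsurj (MonoidHom.range_eq_top.1 h)
  obtain ⟨ψ, hψφ, hψ⟩ := isProP_crSemidirect.exists_le_ker_of_isClosed
    (isCompact_range φ.continuous_toFun).isClosed hne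
  obtain ⟨S, hS⟩ := exists_toAdd_eq_sum_crCoord ψ
  have hzero := R.eq_zero_of_sum_mul_crCoord_eq_zero fun s =>
    ⟨φ s, hφ s, (hS (φ s)).symm.trans (congrArg Multiplicative.toAdd (hψφ ⟨s, rfl⟩))⟩
  refine hψ (ContinuousMonoidHom.ext fun g => Multiplicative.toAdd.injective ?_)
  rw [hS, Finset.sum_eq_zero fun j hj => by rw [hzero j hj, zero_mul]]
  rfl

theorem nonempty_galois_equiv [IsGalois F K] (R : RadicalSystem p k I F K) (h2 : p = 2 → 2 ≤ k)
    (hk : 1 ≤ k) : Nonempty (Gal(K/F) ≃ₜ* CRSemidirect p k hk I) := by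
  obtain ⟨φ, hφ⟩ := exists_continuousMonoidHom_of_isClosed R.isClosed_setOf_actsAs
    (fun x hx y hy => hx.mul hy) (R.existsUnique_actsAs h2 hk)
  refine ⟨continuousMulEquivOfBijective φ ⟨?_, surjective_of_actsAs hφ⟩⟩
  refine (injective_iff_map_eq_one φ).2 fun s hs => ActsAs.eq_one (R := R) (hk := hk) ?_
  exact hs ▸ hφ s

end RadicalSystem

end Galois

section RootSequences

variable {p : ℕ}

theorem isPrimitiveRoot_of_pow_prime {M : Type*} [CommMonoid M] [hp : Fact p.Prime] {x : M} {n : ℕ}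
    (h : IsPrimitiveRoot (x ^ p) (p ^ (n + 1))) : IsPrimitiveRoot x (p ^ (n + 2)) := by
  rw [IsPrimitiveRoot.iff_orderOf]
  refine orderOf_eq_prime_pow (n := n + 1) ?_ ?_
  · rw [pow_succ', pow_mul]
    exact h.pow_ne_one_of_pos_of_lt (pow_ne_zero _ hp.out.ne_zero)
      (Nat.pow_lt_pow_right hp.out.one_lt n.lt_succ_self)
  · rw [pow_succ', pow_mul]
    exact h.pow_eq_one

theorem not_exists_eq_pow_of_isPrimitiveRoot {M : Type*} [CommMonoid M] {k : ℕ} [Fact p.Prime]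
    (hk : 1 ≤ k) (hnot : ¬ ∃ ζ : M, IsPrimitiveRoot ζ (p ^ (k + 1))) {z : M}
    (hz : IsPrimitiveRoot z (p ^ k)) : ¬ ∃ y, z = y ^ p := by
  rintro ⟨y, rfl⟩
  obtain ⟨m, rfl⟩ := Nat.exists_eq_add_of_le' hk
  exact hnot ⟨y, isPrimitiveRoot_of_pow_prime hz⟩

theorem natCast_ne_zero_of_isPrimitiveRoot {R : Type*} [CommRing R] [IsDomain R] {k : ℕ}
    [hp : Fact p.Prime] (hk : 1 ≤ k) {ζ : R} (hζ : IsPrimitiveRoot ζ (p ^ k)) : (p : R) ≠ 0 := by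
  have : NeZero (p ^ k) := ⟨pow_ne_zero _ hp.out.ne_zero⟩
  have h := hζ.neZero'.out
  rw [Nat.cast_pow] at h
  exact (pow_ne_zero_iff (by omega)).1 h

variable {F K : Type*} [Field F] [Field K] [Algebra F K]
  (hroot : ∀ x ∈ radicals p F K, ∃ y ∈ radicals p F K, y ^ p = x)

theorem algebraMap_mem_radicals (c : Fˣ) : algebraMap F K c ∈ radicals p F K :=
  ⟨0, c, by rw [pow_zero, pow_one]⟩

include hroot

theorem exists_root_sequence (c : Fˣ) :
    ∃ u : ℕ → K, u 0 = algebraMap F K c ∧ ∀ n, u (n + 1) ^ p = u n := by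
  have hstep (x : radicals p F K) : ∃ y : radicals p F K, (y : K) ^ p = x :=
    let ⟨y, hy, hyx⟩ := hroot x x.2
    ⟨⟨y, hy⟩, hyx⟩
  choose f hf using hstep
  let v : ℕ → radicals p F K := fun n => f^[n] ⟨_, algebraMap_mem_radicals c⟩
  refine ⟨fun n => v n, rfl, fun n => ?_⟩
  simp only [v, Function.iterate_succ_apply', hf]

theorem exists_zeta_sequence [hp : Fact p.Prime] {ξ : F} (hξ : IsPrimitiveRoot ξ p) :
    ∃ u : ℕ → K, (∀ n, IsPrimitiveRoot (u n) (p ^ n)) ∧ ∀ n, u (n + 1) ^ p = u n := by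
  obtain ⟨u, hu0, hu⟩ := exists_root_sequence hroot (Units.mk0 ξ (hξ.ne_zero hp.out.ne_zero))
  have hprim (n : ℕ) : IsPrimitiveRoot (u n) (p ^ (n + 1)) := by
    induction n with
    | zero =>
      rw [hu0, zero_add, pow_one]
      exact hξ.map_of_injective (algebraMap F K).injective
    | succ n ih => exact isPrimitiveRoot_of_pow_prime (hu n ▸ ih)
  refine ⟨fun n => n.casesOn 1 u, ?_, ?_⟩
  · rintro (_ | n)
    · exact pow_zero p ▸ IsPrimitiveRoot.one
    · exact hprim n
  · rintro (_ | n)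
    · change u 0 ^ p = 1
      rw [← (hprim 0).pow_eq_one, zero_add, pow_one]
    · exact hu n

theorem exists_zeta_sequence_eq_algebraMap [hp : Fact p.Prime] {k : ℕ} (hk : 1 ≤ k)
    (hmem : ∃ ζ : F, IsPrimitiveRoot ζ (p ^ k)) :
    ∃ (u : ℕ → K) (z : Fˣ), (∀ n, IsPrimitiveRoot (u n) (p ^ n)) ∧ (∀ n, u (n + 1) ^ p = u n) ∧
      u k = algebraMap F K z := by
  obtain ⟨ξ, hξ⟩ := hmem
  have hpk : p ^ k ≠ 0 := pow_ne_zero _ hp.out.ne_zero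
  have : NeZero (p ^ k) := ⟨hpk⟩
  obtain ⟨u, hprim, hu⟩ := exists_zeta_sequence hroot <| hξ.pow hpk.bot_lt
    (by rw [← pow_succ, Nat.sub_add_cancel hk] : p ^ k = p ^ (k - 1) * p)
  obtain ⟨j, -, hj⟩ := (hξ.map_of_injective (algebraMap F K).injective).eq_pow_of_pow_eq_one
    (hprim k).pow_eq_one
  exact ⟨u, Units.mk0 ξ (hξ.ne_zero hpk) ^ j, hprim, hu, by
    rw [← hj, Units.val_pow_eq_pow_val, Units.val_mk0, map_pow]⟩

end RootSequences

section CR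

variable {F : Type*} [Field F] {p : ℕ}

theorem CR_eq_adjoin :
    CR F p = IntermediateField.adjoin F (radicals p F (SeparableClosure F)) := by
  refine le_antisymm (iSup_le fun a => iSup_le fun m => iSup_le fun _ => ?_) ?_
  · refine IntermediateField.adjoin.mono _ _ _ ?_
    rintro x (hx | hx)
    · exact ⟨m, a, hx⟩
    · exact ⟨m, 1, by rw [Units.val_one, map_one]; exact hx⟩
  · refine IntermediateField.adjoin_le_iff.2 ?_
    rintro x ⟨m, c, hx⟩
    have hle : radicalExt F p (c ^ p) (m + 1) ≤ CR F p :=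
      le_iSup_of_le _ (le_iSup_of_le _ (le_iSup_of_le (Nat.le_add_left 1 m) le_rfl))
    refine hle (IntermediateField.subset_adjoin _ _ (Or.inl ?_))
    change x ^ p ^ (m + 1) = _
    rw [pow_succ, pow_mul, hx, Units.val_pow_eq_pow_val, map_pow]

theorem isGalois_CR (F : Type*) [Field F] (p : ℕ) : IsGalois F (CR F p) := by
  have hnormal : Normal F (CR F p) := by
    refine IntermediateField.normal_iff_forall_map_le.2 fun σ => ?_
    rw [CR_eq_adjoin, IntermediateField.adjoin_map]
    refine IntermediateField.adjoin.mono _ _ _ ?_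
    rintro _ ⟨x, ⟨m, c, hx⟩, rfl⟩
    exact ⟨m, c, by rw [← map_pow, hx, AlgHom.commutes]⟩
  exact ⟨⟩

theorem adjoin_radicals_CR : IntermediateField.adjoin F (radicals p F (CR F p)) = ⊤ := by
  refine IntermediateField.lift_injective _ ?_
  rw [IntermediateField.lift_adjoin, IntermediateField.lift_top]
  conv_rhs => rw [CR_eq_adjoin]
  congr 1
  ext x
  constructor
  · rintro ⟨y, ⟨m, c, hy⟩, rfl⟩
    exact ⟨m, c, congrArg Subtype.val hy⟩
  · rintro ⟨m, c, hx⟩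
    have hmem : x ∈ CR F p := CR_eq_adjoin.ge (IntermediateField.subset_adjoin _ _ ⟨m, c, hx⟩)
    exact ⟨⟨x, hmem⟩, ⟨m, c, Subtype.ext hx⟩, rfl⟩

theorem exists_pow_eq_of_mem_radicals_CR (hp : (p : F) ≠ 0) :
    ∀ x ∈ radicals p F (CR F p), ∃ y ∈ radicals p F (CR F p), y ^ p = x := by
  rintro x ⟨m, c, hx⟩
  have : NeZero (p : SeparableClosure F) :=
    ⟨by rw [← map_natCast (algebraMap F (SeparableClosure F))]; exact (map_ne_zero _).2 hp⟩
  obtain ⟨y, hy⟩ := IsSepClosed.exists_pow_nat_eq (x : SeparableClosure F) p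
  have hpow : y ^ p ^ (m + 1) = algebraMap F (SeparableClosure F) c := by
    rw [pow_succ', pow_mul, hy]
    exact congrArg Subtype.val hx
  have hmem : y ∈ CR F p := CR_eq_adjoin.ge (IntermediateField.subset_adjoin _ _ ⟨_, c, hpow⟩)
  exact ⟨⟨y, hmem⟩, ⟨m + 1, c, Subtype.ext hpow⟩, Subtype.ext hy⟩

end CR

section Rank

variable {R : Type*} {M : Type u} [Field R] [AddCommGroup M] [Module R M] {x : M}

theorem exists_mk_add_one_eq_rank (hx : x ≠ 0) :
    ∃ I : Type u, Cardinal.mk I + 1 = Module.rank R M := by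
  have : Nontrivial M := ⟨x, 0, hx⟩
  obtain ⟨d, hd⟩ := exists_add_of_le (Cardinal.one_le_iff_pos.2 (rank_pos (R := R) (M := M)))
  exact ⟨d.out, by rw [Cardinal.mk_out, hd, add_comm]⟩

theorem exists_basis_option {I : Type u} (hx : x ≠ 0)
    (hI : Cardinal.mk I + 1 = Module.rank R M) :
    ∃ b : Module.Basis (Option I) R M, b none = x := by
  classical
  have hli : LinearIndepOn R id {x} := LinearIndepOn.singleton hx
  let b := Module.Basis.extend hli
  let i₀ : hli.extend (Set.subset_univ _) := ⟨x, hli.subset_extend _ (Set.mem_singleton x)⟩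
  rw [← b.mk_eq_rank'', ← Cardinal.mk_option] at hI
  obtain ⟨e⟩ := Cardinal.eq.1 hI.symm
  refine ⟨b.reindex (e.trans (Equiv.swap (e i₀) none)), ?_⟩
  rw [Module.Basis.reindex_apply]
  simp [b, i₀, Module.Basis.extend_apply_self]

end Rank

section Existence

variable {F : Type u} [Field F] {p k : ℕ} [hp : Fact p.Prime]

theorem mkQ_ofMul_ne_zero_of_isPrimitiveRoot (hk : 1 ≤ k)
    (hnot : ¬ ∃ ζ : F, IsPrimitiveRoot ζ (p ^ (k + 1))) {z : Fˣ}
    (hz : IsPrimitiveRoot (z : F) (p ^ k)) : ModN.mkQ p (Additive.ofMul z) ≠ 0 := by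
  rw [ne_eq, mkQ_ofMul_eq_zero_iff]
  refine not_exists_eq_pow_of_isPrimitiveRoot hk ?_ (IsPrimitiveRoot.coe_units_iff.1 hz)
  rintro ⟨ζ, hζ⟩
  exact hnot ⟨ζ, IsPrimitiveRoot.coe_units_iff.2 hζ⟩

theorem exists_mk_add_one_eq_rank_modN (hk : 1 ≤ k) (hmem : ∃ ζ : F, IsPrimitiveRoot ζ (p ^ k))
    (hnot : ¬ ∃ ζ : F, IsPrimitiveRoot ζ (p ^ (k + 1))) :
    ∃ I : Type u, Cardinal.mk I + 1 = Module.rank (ZMod p) (ModN (Additive Fˣ) p) := by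
  obtain ⟨ξ, hξ⟩ := hmem
  exact exists_mk_add_one_eq_rank (mkQ_ofMul_ne_zero_of_isPrimitiveRoot hk hnot
    (z := Units.mk0 ξ (hξ.ne_zero (pow_ne_zero _ hp.out.ne_zero))) hξ)

theorem nonempty_radicalSystem (hk : 1 ≤ k) (hmem : ∃ ζ : F, IsPrimitiveRoot ζ (p ^ k))
    (hnot : ¬ ∃ ζ : F, IsPrimitiveRoot ζ (p ^ (k + 1))) {I : Type u}
    (hI : Cardinal.mk I + 1 = Module.rank (ZMod p) (ModN (Additive Fˣ) p)) :
    Nonempty (RadicalSystem p k I F (CR F p)) := by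
  have hpF : (p : F) ≠ 0 := hmem.elim fun _ hξ => natCast_ne_zero_of_isPrimitiveRoot hk hξ
  have hroot := exists_pow_eq_of_mem_radicals_CR hpF
  obtain ⟨u, z, hprim, hu, huz⟩ := exists_zeta_sequence_eq_algebraMap hroot hk hmem
  have hz : IsPrimitiveRoot (z : F) (p ^ k) :=
    .of_map_of_injective (huz ▸ hprim k) (algebraMap F (CR F p)).injective
  obtain ⟨b, hb⟩ := exists_basis_option (mkQ_ofMul_ne_zero_of_isPrimitiveRoot hk hnot hz) hI
  choose a ha using fun i : I => mkQ_ofMul_surjective (b (some i))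
  choose w hw0 hw using fun i => exists_root_sequence hroot (a i)
  exact ⟨{
    gen := fun j => j.elim z a
    basis := b
    basis_apply := Option.rec hb fun i => (ha i).symm
    root := fun j n => j.elim (u (k + n)) fun i => w i n
    root_zero := Option.rec huz hw0
    root_succ := Option.rec (fun n => hu (k + n)) hw
    zeta := u
    isPrimitiveRoot := hprim
    zeta_succ := hu
    zeta_add := fun _ => rfl
    adjoin_radicals := adjoin_radicals_CR }⟩

end Existence

end CyclotomicRadical

theorem theorem4p2 {F : Type u} [Field F] (p : ℕ) [Fact p.Prime]
    (hodd : p ≠ 2 → ∃ ζ : F, IsPrimitiveRoot ζ p)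
    (htwo : p = 2 → ∃ ζ : F, IsPrimitiveRoot ζ 4)
    (k : ℕ) (hk : 1 ≤ k)
    (hmem : ∃ ζ : F, IsPrimitiveRoot ζ (p ^ k))
    (hnot : ¬ ∃ ζ : F, IsPrimitiveRoot ζ (p ^ (k + 1))) :
    IsGalois F (CyclotomicRadical.CR F p) ∧
    (∃ I : Type u, Cardinal.mk I + 1 = Module.rank (ZMod p) (ModN (Additive Fˣ) p)) ∧
    ∀ I : Type u, Cardinal.mk I + 1 = Module.rank (ZMod p) (ModN (Additive Fˣ) p) →
      Nonempty (Gal(CyclotomicRadical.CR F p/F) ≃ₜ*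
        CyclotomicRadical.ProPPresented p (CyclotomicRadical.crRelators p k I)) ∧
      ∃ e : CyclotomicRadical.ProPPresented p (CyclotomicRadical.crRelators p k I) ≃ₜ*
          CyclotomicRadical.CRSemidirect p k hk I,
        e (CyclotomicRadical.ProPPresented.of p _ none) =
          SemidirectProduct.inr (Multiplicative.ofAdd 1) ∧
        ∀ i : I, e (CyclotomicRadical.ProPPresented.of p _ (some i)) =
          SemidirectProduct.inl (Multiplicative.ofAdd (by classical exact Pi.single i 1)) := by
  have h2 : p = 2 → 2 ≤ k := by
    rintro rfl
    by_contra hlt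
    obtain rfl : k = 1 := by omega
    exact hnot (htwo rfl)
  have hgal := CyclotomicRadical.isGalois_CR F p
  refine ⟨hgal, CyclotomicRadical.exists_mk_add_one_eq_rank_modN hk hmem hnot, fun I hI => ?_⟩
  obtain ⟨R⟩ := CyclotomicRadical.nonempty_radicalSystem hk hmem hnot hI
  obtain ⟨e₁⟩ := R.nonempty_galois_equiv h2 hk
  obtain ⟨e, he⟩ := CyclotomicRadical.exists_crPresented_equiv p k hk I
  exact ⟨⟨e₁.trans e.symm⟩, e, he none, fun i => he (some i)⟩
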